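/- Let $\mathcal H=(V,E)$ be a hypergraph: $V$ is a finite set and $E$ is a finite multiset of subsets of $V$. Its underlying bipartite graph $\mathrm{Bip}\,\mathcal H$ has node set $V\sqcup E$, with $v\in V$ joined to $e\in E$ iff $v\in e$; assume that $\mathrm{Bip}\,\mathcal H$ is connected. Fix a ribbon structure on $\mathrm{Bip}\,\mathcal H$, that is, for each node $x$ a cyclic permutation $xy\mapsto xy^+$ of the edges incident to $x$, and a basis $(b_0,b_0b_1)$, that is, a node $b_0$ (in $V$ or in $E$) and an edge $b_0b_1$ incident to it. The tour of a spanning tree $T$ of $\mathrm{Bip}\,\mathcal H$ is the sequence of node-edge pairs that starts with $(b_0,b_0b_1)$, in which $(x,xy)$ is followed by $(x,xy^+)$ if $xy\notin T$ and by $(y,yx^+)$ if $xy\in T$, and which stops right before $(b_0,b_0b_1)$ would become current once again. A spanning tree $T$ is a Jaeger tree if, for each edge $ev\notin T$ of $\mathrm{Bip}\,\mathcal H$ with $e\in E$, $v\in V$, the pair $(e,ev)$ comes before $(v,ev)$ in the tour of $T$. A vector $h\in\mathbb Z^E$ is a hypertree if some spanning tree $T$ of $\mathrm{Bip}\,\mathcal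 H$ represents it, meaning that $T$ has degree $h(e)+1$ at each $e\in E$; let $H$ be the set of hypertrees. Each hypertree $h$ is represented by a unique Jaeger tree; for $e,f\in E$ write $e<_h f$ if, in the tour of that tree, the node $e$ is first reached (is first the node of the current pair) before the node $f$ is first reached. Writing $\mathbf 1_e$ for the unit vector of $e$, let $\mathrm{Int}_{em}(h)$ be the set of those $e\in E$ for which $h-\mathbf 1_e+\mathbf 1_f\notin H$ for all $f<_h e$, let $\mathrm{Ext}_{em}(h)$ be the set of those $e\in E$ for which $h+\mathbf 1_e-\mathbf 1_f\notin H$ for all $f<_h e$, and let $$C_{em}(h)=\{y\in\mathbb Z^E : \text{for all } e\in E,\ (y(e)>h(e)\Rightarrow e\in \mathrm{Ext}_{em}(h)) \text{ and } (y(e)<h(e)\Rightarrow e\in \mathrm{Int}_{em}(h))\}.$$ Then: 1. The sets $C_{em}(h)$, $h\in H$, partition $\mathbb Z^E$: each is non-empty, $C_{em}(h)\cap C_{em}(h')=\emptyset$ for distinct $h,h'\in H$, and $\bigcup_{h\in H}C_{em}(h)=\mathbb Z^E$. 2. For each $c\in\mathbb Z^E$ and $h\in H$ with $c\in C_{em}(h)$,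 $$\sum_{e\in E}|h(e)-c(e)|=\min_{s\in H}\sum_{e\in E}|s(e)-c(e)|.$$ -/

import Mathlib

/-- A hypergraph with vertex set `V` and hyperedges indexed by `E`: each `e : E` is a subset of `V`.
Distinct indices may carry the same subset, so the hyperedges form a multiset of subsets. -/
structure MultiHypergraph (V E : Type*) where
  /-- the subset of `V` that is the hyperedge `e` -/
  edge : E → Set V

/-- A ribbon structure on a simple graph: at each node `x`, a cyclic permutation of the edges incident
to `x`. The edge `xy` at `x` is given by its other endpoint `y`. (`IsCycleOn Set.univ` says that the
permutation has a single cycle, which is the identity at a node with one incident edge.) -/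
structure RibbonStructure {W : Type*} (G : SimpleGraph W) where
  /-- `rot x` sends the edge `xy` to the edge `xy⁺` that follows it at `x` -/
  rot : ∀ x : W, Equiv.Perm (G.neighborSet x)
  cyclic : ∀ x : W, (rot x).IsCycleOn Set.univ

namespace RibbonStructure

variable {W : Type*} {G : SimpleGraph W}

/-- The node-edge pair `(x, xy)` is the dart of `G` from `x` to `y`; `next` sends it to `(x, xy⁺)`. -/
def next (R : RibbonStructure G) (d : G.Dart) : G.Dart :=
  ⟨(d.fst, (R.rot d.fst ⟨d.snd, d.adj⟩ : W)), (R.rot d.fst ⟨d.snd, d.adj⟩).2⟩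

open Classical in
/-- One step of the tour of `T`: from `(x, xy)` go to `(x, xy⁺)` if `xy ∉ T`, and to `(y, yx⁺)` if
`xy ∈ T`. -/
noncomputable def tourStep (R : RibbonStructure G) (T : SimpleGraph W) (d : G.Dart) : G.Dart :=
  if T.Adj d.fst d.snd then R.next d.symm else R.next d

/-- The `i`-th node-edge pair of the tour of `T` that starts at the basis `b`. -/
noncomputable def tour (R : RibbonStructure G) (b : G.Dart) (T : SimpleGraph W) (i : ℕ) : G.Dart :=
  (R.tourStep T)^[i] b

/-- The number of node-edge pairs in the tour: it stops right before `b` would become current once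
again. -/
noncomputable def tourLength (R : RibbonStructure G) (b : G.Dart) (T : SimpleGraph W) : ℕ :=
  Function.minimalPeriod (R.tourStep T) b

/-- In the tour of `T`, the node-edge pair `d` is current before the node-edge pair `d'` is. -/
def PairBefore (R : RibbonStructure G) (b : G.Dart) (T : SimpleGraph W) (d d' : G.Dart) : Prop :=
  ∃ i j : ℕ, i < j ∧ j < R.tourLength b T ∧ R.tour b T i = d ∧ R.tour b T j = d'

/-- In the tour of `T`, the node `x` is reached (becomes the current node) for the first time at
step `i`. -/
def FirstReached (R : RibbonStructure G) (b : G.Dart) (T : SimpleGraph W) (x : W) (i : ℕ) : Prop :=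
  i < R.tourLength b T ∧ (R.tour b T i).fst = x ∧ ∀ j < i, (R.tour b T j).fst ≠ x

/-- In the tour of `T`, the first time that `x` is reached is before the first time that `y` is
reached. -/
def ReachedBefore (R : RibbonStructure G) (b : G.Dart) (T : SimpleGraph W) (x y : W) : Prop :=
  ∃ i j : ℕ, R.FirstReached b T x i ∧ R.FirstReached b T y j ∧ i < j

end RibbonStructure

namespace MultiHypergraph

variable {V E : Type*}

/-- The underlying bipartite graph: its nodes are the vertices (`Sum.inl v`, the violet nodes) and the
hyperedges (`Sum.inr e`, the emerald nodes), and `v` is joined to `e` if `v ∈ e`. -/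
def bip (H : MultiHypergraph V E) : SimpleGraph (V ⊕ E) where
  Adj x y := match x, y with
    | Sum.inl v, Sum.inr e => v ∈ H.edge e
    | Sum.inr e, Sum.inl v => v ∈ H.edge e
    | _, _ => False
  symm := ⟨by rintro (v | e) (w | f) h <;> exact h⟩
  loopless := ⟨by rintro (v | e) h <;> exact h⟩

/-- The node-edge pair `(v, ve)`. -/
def violetPair (H : MultiHypergraph V E) {e : E} {v : V} (hev : v ∈ H.edge e) : H.bip.Dart :=
  ⟨(Sum.inl v, Sum.inr e), hev⟩

/-- The node-edge pair `(e, ev)`. -/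
def emeraldPair (H : MultiHypergraph V E) {e : E} {v : V} (hev : v ∈ H.edge e) : H.bip.Dart :=
  ⟨(Sum.inr e, Sum.inl v), hev⟩

/-- `T` is a spanning tree of the underlying bipartite graph (on all of its nodes). -/
def IsSpanningTree (H : MultiHypergraph V E) (T : SimpleGraph (V ⊕ E)) : Prop :=
  T ≤ H.bip ∧ T.IsTree

/-- The spanning tree `T` represents `h`: it has degree `h e + 1` at each hyperedge `e`. -/
def Represents (H : MultiHypergraph V E) (T : SimpleGraph (V ⊕ E)) (h : E → ℤ) : Prop :=
  H.IsSpanningTree T ∧ ∀ e : E, ((T.neighborSet (Sum.inr e)).ncard : ℤ) = h e + 1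

/-- The set of all hypertrees. -/
def hypertrees (H : MultiHypergraph V E) : Set (E → ℤ) :=
  {h | ∃ T : SimpleGraph (V ⊕ E), H.Represents T h}

/-- `T` is a Jaeger tree: a spanning tree in whose tour each non-edge `ev ∉ T` is first seen at its
emerald endpoint. -/
def IsJaegerTree (H : MultiHypergraph V E) (R : RibbonStructure H.bip) (b : H.bip.Dart)
    (T : SimpleGraph (V ⊕ E)) : Prop :=
  H.IsSpanningTree T ∧
    ∀ (e : E) (v : V) (hev : v ∈ H.edge e), ¬ T.Adj (Sum.inr e) (Sum.inl v) →
      R.PairBefore b T (H.emeraldPair hev) (H.violetPair hev)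

/-- The order `e <_h f` on the hyperedges: in the tour of the (unique) Jaeger tree representing `h`,
the hyperedge `e` is reached for the first time before `f` is. -/
def orderLT (H : MultiHypergraph V E) (R : RibbonStructure H.bip) (b : H.bip.Dart)
    (h : E → ℤ) (e f : E) : Prop :=
  ∃ T : SimpleGraph (V ⊕ E), H.IsJaegerTree R b T ∧ H.Represents T h ∧
    R.ReachedBefore b T (Sum.inr e) (Sum.inr f)

/-- The internally embedding active hyperedges of `h`. -/
def intEm [DecidableEq E] (H : MultiHypergraph V E) (R : RibbonStructure H.bip) (b : H.bip.Dart)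
    (h : E → ℤ) : Set E :=
  {e | ∀ f : E, H.orderLT R b h f e → h - Pi.single e 1 + Pi.single f 1 ∉ H.hypertrees}

/-- The externally embedding active hyperedges of `h`. -/
def extEm [DecidableEq E] (H : MultiHypergraph V E) (R : RibbonStructure H.bip) (b : H.bip.Dart)
    (h : E → ℤ) : Set E :=
  {e | ∀ f : E, H.orderLT R b h f e → h + Pi.single e 1 - Pi.single f 1 ∉ H.hypertrees}

/-- The embedding Crapo interval of `h`. -/
def crapoEm [DecidableEq E] (H : MultiHypergraph V E) (R : RibbonStructure H.bip) (b : H.bip.Dart)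
    (h : E → ℤ) : Set (E → ℤ) :=
  {y | ∀ e : E, (h e < y e → e ∈ H.extEm R b h) ∧ (y e < h e → e ∈ H.intEm R b h)}

end MultiHypergraph

/-- The Manhattan distance of two integer vectors. -/
def manhattanDist {E : Type*} [Fintype E] (s c : E → ℤ) : ℤ :=
  ∑ e, |s e - c e|

namespace SimpleGraph

variable {W : Type*}

/-- Removing the edge `xy` from a graph separates at most the walks that use it. -/
theorem Reachable.deleteEdge_or {F : SimpleGraph W} {x y p q : W} (h : F.Reachable p q) :
    (F.deleteEdges {s(x, y)}).Reachable p q ∨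
      ((F.deleteEdges {s(x, y)}).Reachable p x ∧ (F.deleteEdges {s(x, y)}).Reachable y q) ∨
      ((F.deleteEdges {s(x, y)}).Reachable p y ∧ (F.deleteEdges {s(x, y)}).Reachable x q) := by
  obtain ⟨w⟩ := h
  induction w with
  | nil => exact Or.inl (Reachable.refl _)
  | @cons a b c hab w ih =>
    by_cases he : s(a, b) = s(x, y)
    · rw [Sym2.eq_iff] at he
      rcases he with ⟨rfl, rfl⟩ | ⟨rfl, rfl⟩
      · rcases ih with h | ⟨_, h⟩ | ⟨_, h⟩
        · exact Or.inr (Or.inl ⟨Reachable.refl _, h⟩)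
        · exact Or.inr (Or.inl ⟨Reachable.refl _, h⟩)
        · exact Or.inl h
      · rcases ih with h | ⟨_, h⟩ | ⟨_, h⟩
        · exact Or.inr (Or.inr ⟨Reachable.refl _, h⟩)
        · exact Or.inl h
        · exact Or.inr (Or.inr ⟨Reachable.refl _, h⟩)
    · have hab' : (F.deleteEdges {s(x, y)}).Reachable a b := by
        apply Adj.reachable
        simp only [deleteEdges_adj, Set.mem_singleton_iff]
        exact ⟨hab, he⟩
      rcases ih with h | ⟨h, h'⟩ | ⟨h, h'⟩
      · exact Or.inl (hab'.trans h)
      · exact Or.inr (Or.inl ⟨hab'.trans h, h'⟩)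
      · exact Or.inr (Or.inr ⟨hab'.trans h, h'⟩)

theorem Reachable.mem_of_closed {F : SimpleGraph W} {S : Set W}
    (hS : ∀ p q, F.Adj p q → p ∈ S → q ∈ S) {p q : W} (h : F.Reachable p q) (hp : p ∈ S) :
    q ∈ S := by
  obtain ⟨w⟩ := h
  induction w with
  | nil => exact hp
  | cons hab _ ih => exact ih (hS _ _ hab hp)

theorem Reachable.of_forall_adj {F G : SimpleGraph W}
    (h : ∀ p q, F.Adj p q → G.Reachable p q) {p q : W} (hpq : F.Reachable p q) :
    G.Reachable p q := by
  obtain ⟨w⟩ := hpq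
  induction w with
  | nil => exact Reachable.refl _
  | cons hab _ ih => exact (h _ _ hab).trans ih

theorem IsAcyclic.not_reachable_deleteEdge {F : SimpleGraph W} (hF : F.IsAcyclic) {x y : W}
    (h : F.Adj x y) : ¬ (F.deleteEdges {s(x, y)}).Reachable x y := by
  have := isAcyclic_iff_forall_adj_isBridge.1 hF h
  rwa [isBridge_iff] at this

open Classical in
theorem IsAcyclic.card_connectedComponent_deleteEdge [Finite W] {F : SimpleGraph W}
    (hF : F.IsAcyclic) {x y : W} (h : F.Adj x y) :
    Nat.card (F.deleteEdges {s(x, y)}).ConnectedComponent =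
      Nat.card F.ConnectedComponent + 1 := by
  set F' := F.deleteEdges {s(x, y)} with hF'
  have hle : F' ≤ F := deleteEdges_le _
  have hxy := hF.not_reachable_deleteEdge h
  rw [← Finite.card_option]
  let φ : F'.ConnectedComponent → Option F.ConnectedComponent := fun c =>
    if c = F'.connectedComponentMk x then none else some (c.map (Hom.ofLE hle))
  apply Nat.card_congr
  refine Equiv.ofBijective φ ⟨?_, ?_⟩
  · intro c d
    induction c using ConnectedComponent.ind with | _ p
    induction d using ConnectedComponent.ind with | _ q
    intro hcd
    simp only [φ] at hcd
    split_ifs at hcd with h1 h2 h2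
    · rw [h1, h2]
    · simp only [ConnectedComponent.map_mk, Option.some.injEq, ConnectedComponent.eq,
        Hom.coe_ofLE, id_eq] at hcd h1 h2 ⊢
      rcases hcd.deleteEdge_or (x := x) (y := y) with h | ⟨h, _⟩ | ⟨_, h⟩
      · exact h
      · exact absurd h h1
      · exact absurd h.symm h2
  · rintro (_ | c)
    · exact ⟨F'.connectedComponentMk x, by simp [φ]⟩
    · induction c using ConnectedComponent.ind with | _ p
      by_cases hp : F'.Reachable p x
      · refine ⟨F'.connectedComponentMk y, ?_⟩
        have : ¬ F'.Reachable y x := fun h => hxy h.symm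
        simp only [φ, ConnectedComponent.eq, this, if_false, ConnectedComponent.map_mk,
          Option.some.injEq, Hom.coe_ofLE, id_eq]
        exact (h.reachable.symm.trans (hp.mono hle).symm)
      · exact ⟨F'.connectedComponentMk p, by simp [φ, ConnectedComponent.eq, hp]⟩

/-- In a finite forest, the numbers of edges and of components add up to the number of nodes. -/
theorem IsAcyclic.ncard_edgeSet_add_card_connectedComponent [Finite W] {F : SimpleGraph W}
    (hF : F.IsAcyclic) : F.edgeSet.ncard + Nat.card F.ConnectedComponent = Nat.card W := by
  induction hn : F.edgeSet.ncard generalizing F with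
  | zero =>
    rw [Set.ncard_eq_zero, edgeSet_eq_empty] at hn
    subst hn
    rw [zero_add]
    refine Nat.card_congr (Equiv.ofBijective (connectedComponentMk (⊥ : SimpleGraph W))
      ⟨fun p q h => ?_, fun c => ?_⟩).symm
    · simpa [ConnectedComponent.eq] using h
    · induction c using ConnectedComponent.ind with | _ p
      exact ⟨p, rfl⟩
  | succ n ih =>
    have hne : F.edgeSet.Nonempty := by
      rw [← Set.ncard_pos]; omega
    obtain ⟨e, he⟩ := hne
    induction e with | _ x y
    have h1 := hF.card_connectedComponent_deleteEdge he
    have h2 := ih (F := F.deleteEdges {s(x, y)}) (hF.anti (deleteEdges_le _)) (by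
      rw [edgeSet_deleteEdges, Set.ncard_sdiff_singleton_of_mem he, hn]; rfl)
    rw [h1] at h2
    rw [← h2]; ring

/-- `S` is the side of `y` when the edge `xy` of the forest `T` is removed: `xy` is the only
edge of `T` that leaves `S`. -/
structure IsCut (T : SimpleGraph W) (x y : W) (S : Set W) : Prop where
  adj : T.Adj x y
  notMem : x ∉ S
  mem : y ∈ S
  eq_of_cross : ∀ p q, T.Adj p q → p ∈ S → q ∉ S → p = y ∧ q = x

theorem IsCut.compl {T : SimpleGraph W} {x y : W} {S : Set W} (h : T.IsCut x y S) :
    T.IsCut y x Sᶜ where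
  adj := h.adj.symm
  notMem := fun h' => h' h.mem
  mem := h.notMem
  eq_of_cross p q hpq hp hq := (h.eq_of_cross q p hpq.symm (not_not.1 hq) hp).symm

theorem IsAcyclic.exists_isCut {T : SimpleGraph W} (hT : T.IsAcyclic) {x y : W}
    (h : T.Adj x y) : ∃ S, T.IsCut x y S := by
  refine ⟨{z | (T.deleteEdges {s(x, y)}).Reachable y z}, h, ?_, Reachable.refl _, ?_⟩
  · exact fun h' => hT.not_reachable_deleteEdge h h'.symm
  · intro p q hpq hp hq
    by_contra hne
    apply hq
    refine Reachable.trans hp (Adj.reachable ?_)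
    simp only [deleteEdges_adj, Set.mem_singleton_iff, Sym2.eq_iff]
    refine ⟨hpq, ?_⟩
    rintro (⟨rfl, rfl⟩ | ⟨rfl, rfl⟩)
    · exact hT.not_reachable_deleteEdge h (Reachable.symm hp)
    · exact hne ⟨rfl, rfl⟩

theorem IsCut.mem_of_reachable {T : SimpleGraph W} {x y : W} {S : Set W} (h : T.IsCut x y S)
    {p q : W} (hpq : (T.deleteEdges {s(x, y)}).Reachable p q) (hp : p ∈ S) : q ∈ S := by
  refine hpq.mem_of_closed (fun p q hpq hp => ?_) hp
  by_contra hq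
  simp only [deleteEdges_adj, Set.mem_singleton_iff] at hpq
  obtain ⟨rfl, rfl⟩ := h.eq_of_cross p q hpq.1 hp hq
  exact hpq.2 Sym2.eq_swap

/-- The graph obtained from `T` by replacing the edge `xy` by `pq`. -/
def swapEdge (T : SimpleGraph W) (x y p q : W) : SimpleGraph W :=
  T.deleteEdges {s(x, y)} ⊔ edge p q

theorem swapEdge_adj {T : SimpleGraph W} {x y p q : W} (hpq : p ≠ q) {a b : W} :
    (T.swapEdge x y p q).Adj a b ↔ T.Adj a b ∧ s(a, b) ≠ s(x, y) ∨ s(a, b) = s(p, q) := by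
  simp only [swapEdge, sup_adj, deleteEdges_adj, Set.mem_singleton_iff, edge_adj, Sym2.eq_iff, ne_eq]
  refine or_congr Iff.rfl ⟨fun h => by tauto, fun h => ⟨by tauto, ?_⟩⟩
  rintro rfl
  grind

theorem IsCut.isTree_swapEdge {T : SimpleGraph W} (hT : T.IsTree) {x y p q : W} {S : Set W}
    (h : T.IsCut x y S) (hp : p ∉ S) (hq : q ∈ S) : (T.swapEdge x y p q).IsTree := by
  have hpq : p ≠ q := fun h => hp (h ▸ hq)
  have hnr : ¬ (T.deleteEdges {s(x, y)}).Reachable p q := fun h' =>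
    hp (h.mem_of_reachable h'.symm hq)
  refine ⟨?_, (hT.isAcyclic.anti (deleteEdges_le _)).sup_edge_of_not_reachable hnr⟩
  have hle : T.deleteEdges {s(x, y)} ≤ T.swapEdge x y p q := le_sup_left
  have hpx : (T.deleteEdges {s(x, y)}).Reachable p x := by
    rcases (hT.connected p x).deleteEdge_or (x := x) (y := y) with h' | ⟨h', _⟩ | ⟨h', _⟩
    · exact h'
    · exact h'
    · exact absurd (h.mem_of_reachable h'.symm h.mem) hp
  have hqy : (T.deleteEdges {s(x, y)}).Reachable q y := by
    rcases (hT.connected q y).deleteEdge_or (x := x) (y := y) with h' | ⟨h', _⟩ | ⟨h', _⟩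
    · exact h'
    · exact absurd (h.mem_of_reachable h' hq) h.notMem
    · exact h'
  have hxy : (T.swapEdge x y p q).Reachable x y := by
    refine ((hpx.mono hle).symm.trans (Adj.reachable ?_)).trans (hqy.mono hle)
    rw [swapEdge_adj hpq]; exact Or.inr rfl
  have := hT.connected.nonempty
  refine ⟨fun a b => Reachable.of_forall_adj (F := T) (fun c d hcd => ?_) (hT.connected a b)⟩
  by_cases he : s(c, d) = s(x, y)
  · rw [Sym2.eq_iff] at he
    rcases he with ⟨rfl, rfl⟩ | ⟨rfl, rfl⟩
    · exact hxy
    · exact hxy.symm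
  · exact Adj.reachable ((swapEdge_adj hpq).2 (Or.inl ⟨hcd, he⟩))

/-- If the walk `p` is the path from `a` to `b` in the forest `T`, each of its edges
separates `a` from `b`. -/
theorem IsAcyclic.exists_isCut_of_mem_edges {T : SimpleGraph W} (hT : T.IsAcyclic) {a b : W}
    {w : T.Walk a b} (hw : w.IsPath) {ε : Sym2 W} (hε : ε ∈ w.edges) :
    ∃ x y S, ε = s(x, y) ∧ T.IsCut x y S ∧ a ∉ S ∧ b ∈ S := by
  classical
  induction ε with | _ x y
  have hxy : T.Adj x y := w.adj_of_mem_edges hε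
  have hnr : ¬ (T.deleteEdges {s(x, y)}).Reachable a b := by
    rw [reachable_deleteEdges_iff_exists_walk]
    rintro ⟨q, hq⟩
    have h1 : w = (q.toPath : T.Walk a b) :=
      congrArg Subtype.val ((hT.subsingleton_path a b).elim ⟨w, hw⟩ q.toPath)
    rw [h1] at hε
    exact hq (q.edges_bypass_subset_edges hε)
  have hab : T.Reachable a b := ⟨w⟩
  obtain ⟨S, hS⟩ := hT.exists_isCut hxy
  rcases hab.deleteEdge_or (x := x) (y := y) with h | ⟨h, h'⟩ | ⟨h, h'⟩
  · exact absurd h hnr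
  · refine ⟨x, y, S, rfl, hS, fun ha => hS.notMem (hS.mem_of_reachable h ha),
      hS.mem_of_reachable h' hS.mem⟩
  · refine ⟨y, x, Sᶜ, Sym2.eq_swap, hS.compl, fun ha => ha (hS.mem_of_reachable h.symm hS.mem), ?_⟩
    exact fun hb => hS.notMem (hS.mem_of_reachable h'.symm hb)

/-- The exchange property of spanning trees. -/
theorem IsTree.exists_isCut_of_adj {T T₁ : SimpleGraph W} (hT : T.IsTree) (hT₁ : T₁.IsAcyclic)
    {a b : W} (h₁ : T₁.Adj a b) (h : ¬ T.Adj a b) :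
    ∃ x y S, T.IsCut x y S ∧ ¬ T₁.Adj x y ∧ a ∉ S ∧ b ∈ S := by
  classical
  obtain ⟨w, hw⟩ := (hT.connected a b).exists_isPath
  by_cases hall : ∀ ε ∈ w.edges, ε ∈ T₁.edgeSet
  · exfalso
    apply hT₁.not_reachable_deleteEdge h₁
    refine ⟨w.transfer _ fun ε hε => ?_⟩
    rw [edgeSet_deleteEdges]
    refine ⟨hall ε hε, ?_⟩
    rintro rfl
    exact h (w.adj_of_mem_edges hε)
  · push Not at hall
    obtain ⟨ε, hε, hε₁⟩ := hall
    obtain ⟨x, y, S, rfl, hS, ha, hb⟩ := hT.isAcyclic.exists_isCut_of_mem_edges hw hε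
    exact ⟨x, y, S, hS, hε₁, ha, hb⟩

end SimpleGraph

namespace MultiHypergraph

open SimpleGraph Finset

variable {V E : Type*}

/-- The edges of `T` whose emerald end belongs to `X`. -/
def emRestrict (T : SimpleGraph (V ⊕ E)) (X : Finset E) : SimpleGraph (V ⊕ E) where
  Adj x y := T.Adj x y ∧ (∀ e, x = Sum.inr e → e ∈ X) ∧ (∀ e, y = Sum.inr e → e ∈ X)
  symm := ⟨fun _ _ h => ⟨h.1.symm, h.2.2, h.2.1⟩⟩
  loopless := ⟨fun _ h => h.1.ne rfl⟩

/-- The vector that is one less than the degrees of `T` at the hyperedges. -/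
noncomputable def emVector (T : SimpleGraph (V ⊕ E)) (e : E) : ℤ :=
  (T.neighborSet (Sum.inr e)).ncard - 1

theorem emRestrict_le (T : SimpleGraph (V ⊕ E)) (X : Finset E) : emRestrict T X ≤ T :=
  fun _ _ h => h.1

theorem emRestrict_adj_inr {T : SimpleGraph (V ⊕ E)} {X : Finset E} {e : E} {v : V} :
    (emRestrict T X).Adj (Sum.inr e) (Sum.inl v) ↔
      T.Adj (Sum.inr e) (Sum.inl v) ∧ e ∈ X := by
  simp [emRestrict]

theorem mem_hypertrees {H : MultiHypergraph V E} {h : E → ℤ} :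
    h ∈ H.hypertrees ↔ ∃ T, H.IsSpanningTree T ∧ emVector T = h := by
  refine exists_congr fun T => and_congr Iff.rfl ⟨fun h' => funext fun e => ?_, fun h' e => ?_⟩
  · rw [emVector, h' e]; ring
  · rw [← h', emVector]; ring

theorem represents_iff {H : MultiHypergraph V E} {T : SimpleGraph (V ⊕ E)} {h : E → ℤ} :
    H.Represents T h ↔ H.IsSpanningTree T ∧ emVector T = h := by
  refine and_congr Iff.rfl ⟨fun h' => funext fun e => ?_, fun h' e => ?_⟩
  · rw [emVector, h' e]; ring
  · rw [← h', emVector]; ring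

theorem not_bip_adj_inl {H : MultiHypergraph V E} {v w : V} :
    ¬ H.bip.Adj (Sum.inl v) (Sum.inl w) := id

theorem not_bip_adj_inr {H : MultiHypergraph V E} {e f : E} :
    ¬ H.bip.Adj (Sum.inr e) (Sum.inr f) := id

theorem exists_eq_of_adj {H : MultiHypergraph V E} {x y : V ⊕ E} (h : H.bip.Adj x y) :
    ∃ e v, s(x, y) = s(Sum.inr e, Sum.inl v) ∧ v ∈ H.edge e := by
  rcases x with v | e <;> rcases y with w | f
  · exact h.elim
  · exact ⟨f, v, Sym2.eq_swap, h⟩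
  · exact ⟨e, w, rfl, h⟩
  · exact h.elim

section Count

variable [Fintype V]

open Classical in
theorem emVector_eq_sum {H : MultiHypergraph V E} {T : SimpleGraph (V ⊕ E)} (hT : T ≤ H.bip)
    (e : E) : emVector T e = (∑ v : V, if T.Adj (Sum.inr e) (Sum.inl v) then 1 else 0) - 1 := by
  have : T.neighborSet (Sum.inr e) =
      Sum.inl '' ((univ.filter fun v => T.Adj (Sum.inr e) (Sum.inl v) : Finset V) : Set V) := by
    ext x
    rcases x with v | f
    · simp
    · simpa using fun h => not_bip_adj_inr (hT h)
  rw [emVector, this, Set.ncard_image_of_injective _ Sum.inl_injective, Set.ncard_coe_finset,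
    card_filter]
  push_cast; rfl

open Classical in
theorem ncard_edgeSet_emRestrict {H : MultiHypergraph V E} {T : SimpleGraph (V ⊕ E)}
    (hT : T ≤ H.bip) (X : Finset E) :
    ((emRestrict T X).edgeSet.ncard : ℤ) = ∑ e ∈ X, (emVector T e + 1) := by
  have : (emRestrict T X).edgeSet =
      (fun p : E × V => s(Sum.inr p.1, Sum.inl p.2)) ''
        (((X ×ˢ univ).filter fun p : E × V => T.Adj (Sum.inr p.1) (Sum.inl p.2) :
          Finset (E × V)) : Set (E × V)) := by
    ext ε
    induction ε with | _ x y
    constructor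
    · intro h
      obtain ⟨e, v, hev, -⟩ := exists_eq_of_adj (hT (emRestrict_le T X h))
      rw [hev, mem_edgeSet, emRestrict_adj_inr] at h
      exact ⟨(e, v), by simpa using ⟨h.2, h.1⟩, hev.symm⟩
    · rintro ⟨⟨e, v⟩, h, hev⟩
      rw [← hev, mem_edgeSet, emRestrict_adj_inr]
      simpa [and_comm] using h
  rw [this, Set.InjOn.ncard_image, Set.ncard_coe_finset, card_filter, sum_product]
  · push_cast
    refine sum_congr rfl fun e _ => ?_
    rw [emVector_eq_sum hT]; ring
  · rintro ⟨e, v⟩ - ⟨f, w⟩ - h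
    simpa [Sym2.eq_iff] using h

theorem swapEdge_le_and_emVector_swapEdge [DecidableEq E] {H : MultiHypergraph V E}
    {T : SimpleGraph (V ⊕ E)} (hT : T ≤ H.bip)
    {x y p q : V ⊕ E} {a g : E} {u w : V} (hxy : s(x, y) = s(Sum.inr a, Sum.inl u))
    (hpq : s(p, q) = s(Sum.inr g, Sum.inl w)) (hau : T.Adj (Sum.inr a) (Sum.inl u))
    (hgw : ¬ T.Adj (Sum.inr g) (Sum.inl w)) (hw : w ∈ H.edge g) :
    T.swapEdge x y p q ≤ H.bip ∧
      emVector (T.swapEdge x y p q) = emVector T + Pi.single g 1 - Pi.single a 1 := by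
  classical
  have hne : p ≠ q := by
    rintro rfl
    have : s(p, p).IsDiag := rfl
    rw [hpq] at this
    simp at this
  have hle : T.swapEdge x y p q ≤ H.bip := by
    intro c d hcd
    rw [swapEdge_adj hne] at hcd
    rcases hcd with h | h
    · exact hT h.1
    · rw [hpq] at h
      rw [← mem_edgeSet, h]
      exact hw
  refine ⟨hle, funext fun e => ?_⟩
  have hadj : ∀ v, (if (T.swapEdge x y p q).Adj (Sum.inr e) (Sum.inl v) then (1 : ℤ) else 0) =
      (if T.Adj (Sum.inr e) (Sum.inl v) then 1 else 0) + (if e = g then if v = w then 1 else 0 else 0)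
        - (if e = a then if v = u then 1 else 0 else 0) := by
    intro v
    rw [swapEdge_adj hne, hxy, hpq]
    simp only [ne_eq, Sym2.eq_iff, Sum.inr.injEq, Sum.inl.injEq, reduceCtorEq, and_self, or_false]
    by_cases h1 : e = g ∧ v = w
    · obtain ⟨rfl, rfl⟩ := h1
      have : ¬ (e = a ∧ v = u) := by rintro ⟨rfl, rfl⟩; exact hgw hau
      grind
    · by_cases h2 : e = a ∧ v = u
      · obtain ⟨rfl, rfl⟩ := h2
        grind
      · grind
  rw [emVector_eq_sum hle]
  simp only [hadj, sum_sub_distrib, sum_add_distrib, Pi.sub_apply, Pi.add_apply]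
  rw [emVector_eq_sum hT]
  by_cases h1 : e = g <;> by_cases h2 : e = a <;> simp [h1, h2, Pi.single_apply] <;> grind

end Count

section Exchange

variable [DecidableEq E] {H : MultiHypergraph V E}

/-- The hyperedge `a` can give one unit to `f`. -/
def IsDonor (H : MultiHypergraph V E) (h : E → ℤ) (f a : E) : Prop :=
  h + Pi.single f 1 - Pi.single a 1 ∈ H.hypertrees

theorem isDonor_self {h : E → ℤ} (hh : h ∈ H.hypertrees) (f : E) : IsDonor H h f f := by
  simpa [IsDonor] using hh

theorem isDonor_iff {h : E → ℤ} {f a : E} :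
    IsDonor H h f a ↔ h - Pi.single a 1 + Pi.single f 1 ∈ H.hypertrees := by
  rw [IsDonor, sub_add_eq_add_sub]

variable [Fintype V]

theorem IsSpanningTree.exists_swap {T : SimpleGraph (V ⊕ E)} (hT : H.IsSpanningTree T)
    {x y p q : V ⊕ E} {S : Set (V ⊕ E)} (hS : T.IsCut x y S) (hp : p ∉ S) (hq : q ∈ S)
    {g : E} {w : V} (hpq : s(p, q) = s(Sum.inr g, Sum.inl w)) (hw : w ∈ H.edge g)
    (hgw : ¬ T.Adj (Sum.inr g) (Sum.inl w)) :
    ∃ a u, s(x, y) = s(Sum.inr a, Sum.inl u) ∧ H.IsSpanningTree (T.swapEdge x y p q) ∧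
      emVector (T.swapEdge x y p q) = emVector T + Pi.single g 1 - Pi.single a 1 := by
  obtain ⟨a, u, hxy, -⟩ := exists_eq_of_adj (hT.1 hS.adj)
  have hau : T.Adj (Sum.inr a) (Sum.inl u) := by
    rw [← mem_edgeSet, ← hxy]; exact hS.adj
  have := swapEdge_le_and_emVector_swapEdge hT.1 hxy hpq hau hgw hw
  exact ⟨a, u, hxy, ⟨this.1, hS.isTree_swapEdge hT.2 hp hq⟩, this.2⟩

variable [Fintype E]

theorem exists_exchange {T₁ T₂ : SimpleGraph (V ⊕ E)} (h₁ : H.IsSpanningTree T₁)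
    (h₂ : H.IsSpanningTree T₂) {g : E} (hg : emVector T₂ g < emVector T₁ g) :
    ∃ j, emVector T₁ j < emVector T₂ j ∧
      emVector T₂ + Pi.single g 1 - Pi.single j 1 ∈ H.hypertrees := by
  induction hn : (T₁.edgeSet \ T₂.edgeSet).ncard using Nat.strong_induction_on
    generalizing T₂ g with | _ n ih
  obtain ⟨v, hv₁, hv₂⟩ : ∃ v, T₁.Adj (Sum.inr g) (Sum.inl v) ∧
      ¬ T₂.Adj (Sum.inr g) (Sum.inl v) := by
    by_contra! hcon
    have : T₁.neighborSet (Sum.inr g) ⊆ T₂.neighborSet (Sum.inr g) := by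
      rintro (v | f) h
      · exact hcon v h
      · exact (h₁.1 h).elim
    have := Set.ncard_le_ncard this
    simp only [emVector] at hg
    omega
  obtain ⟨x, y, S, hS, hxy₁, ha, hb⟩ := h₂.2.exists_isCut_of_adj h₁.2.isAcyclic hv₁ hv₂
  obtain ⟨a, u, hxy, hT', hvec⟩ := h₂.exists_swap hS ha hb rfl (h₁.1 hv₁) hv₂
  by_cases hlt : emVector T₁ a < emVector T₂ a
  · exact ⟨a, hlt, mem_hypertrees.2 ⟨_, hT', hvec⟩⟩
  set T' := T₂.swapEdge x y (Sum.inr g) (Sum.inl v) with hT'def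
  have hsub : T₁.edgeSet \ T'.edgeSet ⊂ T₁.edgeSet \ T₂.edgeSet := by
    rw [Set.ssubset_iff_of_subset]
    · refine ⟨s(Sum.inr g, Sum.inl v), ⟨hv₁, hv₂⟩, fun h => h.2 ?_⟩
      rw [mem_edgeSet, hT'def, swapEdge_adj (by simp)]
      exact Or.inr rfl
    · rintro ε ⟨hε₁, hε⟩
      refine ⟨hε₁, fun hε₂ => hε ?_⟩
      induction ε with | _ c d
      rw [mem_edgeSet, hT'def, swapEdge_adj (by simp)]
      refine Or.inl ⟨hε₂, fun h => hxy₁ ?_⟩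
      rw [← mem_edgeSet, ← h]; exact hε₁
  have ha' : emVector T' a < emVector T₁ a := by
    rw [hvec]
    by_cases hag : a = g
    · subst hag; simpa using hg
    · simp [hag]; omega
  obtain ⟨j, hj, hmem⟩ := ih _ (hn ▸ Set.ncard_lt_ncard hsub) hT' ha' rfl
  rw [hvec] at hj hmem
  refine ⟨j, ?_, ?_⟩
  · simp only [Pi.sub_apply, Pi.add_apply, Pi.single_apply] at hj
    split_ifs at hj <;> grind
  · convert hmem using 1
    abel

theorem IsDonor.trans {h : E → ℤ} {f a a' : E} (hh : h ∈ H.hypertrees)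
    (h₁ : IsDonor H h f a) (h₂ : IsDonor H h a a') :
    IsDonor H h f a' := by
  by_cases hfa : f = a
  · exact hfa ▸ h₂
  by_cases haa : a' = a
  · exact haa ▸ h₁
  by_cases hfa' : f = a'
  · exact hfa' ▸ isDonor_self hh f
  obtain ⟨T₁, hT₁, hp⟩ := mem_hypertrees.1 h₁
  obtain ⟨T₂, hT₂, hq⟩ := mem_hypertrees.1 h₂
  obtain ⟨j, hj, hmem⟩ := exists_exchange hT₁ hT₂ (g := f) (by
    rw [hp, hq]; simp [hfa, hfa'])
  have hja : j = a := by
    by_contra hja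
    rw [hp, hq] at hj
    simp only [Pi.sub_apply, Pi.add_apply, Pi.single_apply, hja, if_false] at hj
    split_ifs at hj <;> omega
  rw [hq, hja] at hmem
  rw [IsDonor]
  convert hmem using 1
  abel

end Exchange

end MultiHypergraph

namespace MultiHypergraph

open SimpleGraph Finset

variable {V E : Type*} {H : MultiHypergraph V E}

/-- The edges of `T` at `X` connect all nodes that are joined in the hypergraph by `X`. -/
def Spans (H : MultiHypergraph V E) (T : SimpleGraph (V ⊕ E)) (X : Finset E) : Prop :=
  ∀ e ∈ X, ∀ v ∈ H.edge e, (emRestrict T X).Reachable (Sum.inr e) (Sum.inl v)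

theorem Spans.reachable_of_adj {T T' : SimpleGraph (V ⊕ E)} {X : Finset E} (hX : Spans H T X)
    (hT' : T' ≤ H.bip) {x y : V ⊕ E} (h : (emRestrict T' X).Adj x y) :
    (emRestrict T X).Reachable x y := by
  rcases x with v | e <;> rcases y with w | f
  · exact absurd (hT' h.1) not_bip_adj_inl
  · exact (hX f (h.2.2 f rfl) v (hT' h.1)).symm
  · exact hX e (h.2.1 e rfl) w (hT' h.1)
  · exact absurd (hT' h.1) not_bip_adj_inr

/-- Passing to a union of components preserves spanning. -/
theorem Spans.restrict {T : SimpleGraph (V ⊕ E)} {Y Y' : Finset E} (hY : Spans H T Y)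
    (hT : T ≤ H.bip) (hsub : Y' ⊆ Y)
    (hcl : ∀ g ∈ Y', ∀ g' ∈ Y, ∀ w, T.Adj (Sum.inr g) (Sum.inl w) →
      T.Adj (Sum.inr g') (Sum.inl w) → g' ∈ Y') : Spans H T Y' := by
  intro e he v hv
  have key : ∀ x y, (emRestrict T Y).Reachable x y →
      x ∈ {z | (emRestrict T Y').Reachable (Sum.inr e) z} →
      y ∈ {z | (emRestrict T Y').Reachable (Sum.inr e) z} := by
    intro x y hxy hx
    refine hxy.mem_of_closed (fun p q hpq hp => ?_) hx
    refine Reachable.trans hp (Adj.reachable ?_)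
    rcases p with w | g <;> rcases q with w' | g'
    · exact absurd (hT hpq.1) not_bip_adj_inl
    · obtain ⟨walk⟩ := Reachable.symm hp
      cases walk with
      | @cons _ b _ hadj _ =>
        rcases b with w'' | g
        · exact absurd (hT hadj.1) not_bip_adj_inl
        · refine ⟨hpq.1, by simp, ?_⟩
          rintro _ ⟨⟩
          exact hcl g (hadj.2.2 g rfl) g' (hpq.2.2 g' rfl) w hadj.1.symm hpq.1.symm
    · obtain ⟨walk⟩ := Reachable.symm hp
      refine ⟨hpq.1, ?_, by simp⟩
      rintro _ ⟨⟩
      cases walk with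
      | nil => exact he
      | cons hadj _ => exact hadj.2.1 g rfl
    · exact absurd (hT hpq.1) not_bip_adj_inr
  exact key _ _ (hY e (hsub he) v hv) (Reachable.refl _)

theorem spans_univ [Fintype E] {T : SimpleGraph (V ⊕ E)} (hT : H.IsSpanningTree T) :
    Spans H T univ := by
  intro e _ v _
  exact (hT.2.connected (Sum.inr e) (Sum.inl v)).mono fun a b h => ⟨h, by simp, by simp⟩

/-- A spanned set that misses `e` does not cross the cut of the edge `ev`. -/
theorem Spans.filter_of_isCut {T : SimpleGraph (V ⊕ E)} (hT : T ≤ H.bip) {e : E} {v : V}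
    {S : Set (V ⊕ E)} [DecidablePred fun g : E => (Sum.inr g : V ⊕ E) ∈ S]
    (hS : T.IsCut (Sum.inr e) (Sum.inl v) S) {Y : Finset E}
    (hY : Spans H T Y) (he : e ∉ Y) : Spans H T (Y.filter fun g => Sum.inr g ∈ S) := by
  refine hY.restrict hT (filter_subset _ _) fun g hg g' hg' w hgw hgw' => ?_
  rw [mem_filter] at hg ⊢
  refine ⟨hg', ?_⟩
  have hw : (Sum.inl w : V ⊕ E) ∈ S := by
    by_contra hw
    exact absurd (hS.eq_of_cross _ _ hgw hg.2 hw).1 (by simp)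
  by_contra hg''
  have := (hS.eq_of_cross _ _ hgw'.symm hw hg'').2
  simp only [Sum.inr.injEq] at this
  exact he (this ▸ hg')

variable [Fintype V]

theorem IsSpanningTree.spans_of_closed [DecidableEq E] {T : SimpleGraph (V ⊕ E)}
    (hT : H.IsSpanningTree T) {X : Finset E}
    (hX : ∀ f ∈ X, ∀ a, IsDonor H (emVector T) f a → a ∈ X) : Spans H T X := by
  intro e he v hv
  by_cases hev : T.Adj (Sum.inr e) (Sum.inl v)
  · exact (emRestrict_adj_inr.2 ⟨hev, he⟩).reachable
  obtain ⟨w, hw⟩ := (hT.2.connected (Sum.inr e) (Sum.inl v)).exists_isPath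
  refine ⟨w.transfer _ fun ε hε => ?_⟩
  obtain ⟨x, y, S, rfl, hS, ha, hb⟩ := hT.2.isAcyclic.exists_isCut_of_mem_edges hw hε
  obtain ⟨a, u, hxy, hT', hvec⟩ := hT.exists_swap hS ha hb rfl hv hev
  have hadj : s(x, y) ∈ T.edgeSet := hS.adj
  rw [hxy] at hadj ⊢
  exact emRestrict_adj_inr.2 ⟨hadj, hX e he a (mem_hypertrees.2 ⟨_, hT', hvec⟩)⟩

variable [Fintype E]

theorem Spans.sum_le_and {T T' : SimpleGraph (V ⊕ E)} {X : Finset E} (hX : Spans H T X)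
    (hT : H.IsSpanningTree T) (hT' : H.IsSpanningTree T') :
    ∑ e ∈ X, emVector T' e ≤ ∑ e ∈ X, emVector T e ∧
      (∑ e ∈ X, emVector T' e = ∑ e ∈ X, emVector T e → Spans H T' X) := by
  have h1 := ncard_edgeSet_emRestrict hT.1 X
  have h2 := ncard_edgeSet_emRestrict hT'.1 X
  have c1 := (hT.2.isAcyclic.anti
    (emRestrict_le T X)).ncard_edgeSet_add_card_connectedComponent
  have c2 := (hT'.2.isAcyclic.anti
    (emRestrict_le T' X)).ncard_edgeSet_add_card_connectedComponent
  rw [sum_add_distrib] at h1 h2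
  have hreach : ∀ x y, (emRestrict T' X).Reachable x y → (emRestrict T X).Reachable x y :=
    fun x y => Reachable.of_forall_adj fun p q => hX.reachable_of_adj hT'.1
  let φ : (emRestrict T' X).ConnectedComponent → (emRestrict T X).ConnectedComponent :=
    Quot.map id hreach
  have hφ : Function.Surjective φ := by
    intro c
    induction c using ConnectedComponent.ind with | _ p
    exact ⟨(emRestrict T' X).connectedComponentMk p, rfl⟩
  have hle := Nat.card_le_card_of_surjective φ hφ
  refine ⟨by zify at c1 c2 hle; linarith, fun heq => ?_⟩
  have hcard : Nat.card (emRestrict T' X).ConnectedComponent =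
      Nat.card (emRestrict T X).ConnectedComponent := by
    zify at c1 c2 ⊢; linarith
  have hinj : Function.Injective φ :=
    ((Function.Surjective.bijective_of_nat_card_le hφ hcard.le)).1
  intro e he v hv
  rw [← ConnectedComponent.eq]
  apply hinj
  exact ConnectedComponent.eq.2 (hX e he v hv)

theorem Spans.sum_le {T T' : SimpleGraph (V ⊕ E)} {X : Finset E} (hX : Spans H T X)
    (hT : H.IsSpanningTree T) (hT' : H.IsSpanningTree T') :
    ∑ e ∈ X, emVector T' e ≤ ∑ e ∈ X, emVector T e :=
  (hX.sum_le_and hT hT').1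

theorem Spans.of_sum_eq {T T' : SimpleGraph (V ⊕ E)} {X : Finset E} (hX : Spans H T X)
    (hT : H.IsSpanningTree T) (hT' : H.IsSpanningTree T')
    (h : ∑ e ∈ X, emVector T' e = ∑ e ∈ X, emVector T e) : Spans H T' X :=
  (hX.sum_le_and hT hT').2 h

/-- If `T'` has no edge from a hyperedge outside of `S` to a vertex in `S`, where `S` is the
side of `v` in the spanning tree `T` with the edge `ev` removed, then `T'` has larger degrees in
`S` than `T`, even within the component of `e` in a set spanned by `T'`. -/
theorem sum_lt_sum_of_isCut {T T' : SimpleGraph (V ⊕ E)} (hT : H.IsSpanningTree T)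
    (hT' : H.IsSpanningTree T') {e : E} {v : V} {S : Set (V ⊕ E)}
    (hS : T.IsCut (Sum.inr e) (Sum.inl v) S)
    (hcross : ∀ g w, Sum.inr g ∉ S → Sum.inl w ∈ S → ¬ T'.Adj (Sum.inr g) (Sum.inl w))
    {Z Q : Finset E} (he : e ∈ Z) (hZ : Spans H T' Z)
    (hQ : ∀ g, g ∈ Q ↔
      g ∈ Z ∧ (emRestrict T' Z).Reachable (Sum.inr e) (Sum.inr g) ∧ Sum.inr g ∈ S) :
    ∑ g ∈ Q, emVector T g < ∑ g ∈ Q, emVector T' g := by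
  set R := emRestrict T' Z
  set J : Set (V ⊕ E) := {x | x ∈ S ∧ R.Reachable (Sum.inr e) x} with hJ
  have h1 := ncard_edgeSet_emRestrict hT.1 Q
  have h2 := ncard_edgeSet_emRestrict hT'.1 Q
  have c1 := (hT.2.isAcyclic.anti
    (emRestrict_le T Q)).ncard_edgeSet_add_card_connectedComponent
  have c2 := (hT'.2.isAcyclic.anti
    (emRestrict_le T' Q)).ncard_edgeSet_add_card_connectedComponent
  rw [sum_add_distrib] at h1 h2
  have hvJ : Sum.inl v ∈ J := ⟨hS.mem, hZ e he v (hT.1 hS.adj)⟩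
  have heJ : Sum.inr e ∉ J := fun h => hS.notMem h.1
  have hinr : ∀ g w, (emRestrict T Q).Adj (Sum.inr g) (Sum.inl w) →
      Sum.inr g ∈ J ∧ Sum.inl w ∈ J := by
    intro g w hgw
    obtain ⟨hgw, hg⟩ := emRestrict_adj_inr.1 hgw
    rw [hQ] at hg
    refine ⟨⟨hg.2.2, hg.2.1⟩, ?_, hg.2.1.trans (hZ g hg.1 w (hT.1 hgw))⟩
    by_contra hw
    exact absurd (hS.eq_of_cross _ _ hgw hg.2.2 hw).1 (by simp)
  have hin : ∀ x y, (emRestrict T Q).Adj x y → x ∈ J := by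
    rintro (w | g) (w' | g') h
    · exact absurd (hT.1 h.1) not_bip_adj_inl
    · exact (hinr _ _ h.symm).2
    · exact (hinr _ _ h).1
    · exact absurd (hT.1 h.1) not_bip_adj_inr
  have hiso : ∀ x y, x ∉ J → (emRestrict T Q).Reachable x y → y = x := fun x y hx hxy =>
    hxy.mem_of_closed (S := {x})
      (fun p q hpq hp => absurd (hin p q hpq) (by rwa [Set.mem_singleton_iff.1 hp])) rfl
  have hlow : Nat.card ↥Jᶜ + 1 ≤ Nat.card (emRestrict T Q).ConnectedComponent := by
    rw [← Finite.card_option]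
    refine Nat.card_le_card_of_injective
      (fun o : Option ↥Jᶜ => (emRestrict T Q).connectedComponentMk
        (o.elim (Sum.inl v) Subtype.val)) ?_
    rintro (_ | ⟨x, hx⟩) (_ | ⟨y, hy⟩) h
    · rfl
    · have := hiso y _ hy (ConnectedComponent.eq.1 h).symm
      exact absurd (this ▸ hvJ) hy
    · have := hiso x _ hx (ConnectedComponent.eq.1 h)
      exact absurd (this ▸ hvJ) hx
    · have := hiso x _ hx (ConnectedComponent.eq.1 h)
      simpa using this.symm
  have hexit : ∀ x y, R.Walk x y → R.Reachable (Sum.inr e) x → y ∉ J →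
      ∃ z ∉ J, (emRestrict T' Q).Reachable z x := by
    intro x y w hx hy
    induction w with
    | nil => exact ⟨_, hy, Reachable.refl _⟩
    | @cons a b c hab w ih =>
      by_cases ha : a ∈ J
      · have hb := hx.trans hab.reachable
        obtain ⟨z, hz, hzb⟩ := ih hb hy
        refine ⟨z, hz, hzb.trans (Adj.reachable (Adj.symm ?_))⟩
        rcases a with u | g <;> rcases b with u' | g'
        · exact absurd (hT'.1 hab.1) not_bip_adj_inl
        · refine (emRestrict_adj_inr.2 ⟨hab.1.symm, ?_⟩).symm
          refine (hQ g').2 ⟨hab.2.2 g' rfl, hb, ?_⟩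
          by_contra hg'
          exact hcross g' u hg' ha.1 hab.1.symm
        · exact emRestrict_adj_inr.2 ⟨hab.1, (hQ g).2 ⟨hab.2.1 g rfl, hx, ha.1⟩⟩
        · exact absurd (hT'.1 hab.1) not_bip_adj_inr
      · exact ⟨a, ha, Reachable.refl _⟩
  have hup : Nat.card (emRestrict T' Q).ConnectedComponent ≤ Nat.card ↥Jᶜ := by
    refine Nat.card_le_card_of_surjective
      (fun x : ↥Jᶜ => (emRestrict T' Q).connectedComponentMk x) fun c => ?_
    induction c using ConnectedComponent.ind with | _ p
    by_cases hp : p ∈ J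
    · obtain ⟨w⟩ := hp.2.symm
      obtain ⟨z, hz, hzp⟩ := hexit _ _ w hp.2 heJ
      exact ⟨⟨z, hz⟩, ConnectedComponent.eq.2 hzp⟩
    · exact ⟨⟨p, hp⟩, rfl⟩
  zify at c1 c2 hlow hup
  linarith

open Classical in
theorem sum_lt_sum_of_isCut_univ {T T' : SimpleGraph (V ⊕ E)} (hT : H.IsSpanningTree T)
    (hT' : H.IsSpanningTree T') {e : E} {v : V} {S : Set (V ⊕ E)}
    (hS : T.IsCut (Sum.inr e) (Sum.inl v) S)
    (hcross : ∀ g w, Sum.inr g ∉ S → Sum.inl w ∈ S → ¬ T'.Adj (Sum.inr g) (Sum.inl w)) :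
    ∑ g with Sum.inr g ∈ S, emVector T g < ∑ g with Sum.inr g ∈ S, emVector T' g := by
  refine sum_lt_sum_of_isCut hT hT' hS hcross (mem_univ e) (spans_univ hT') fun g => ?_
  have : (emRestrict T' univ).Reachable (Sum.inr e) (Sum.inr g) :=
    (hT'.2.connected _ _).mono fun a b h => ⟨h, by simp, by simp⟩
  simp [this]

end MultiHypergraph

namespace RibbonStructure

open SimpleGraph

variable {W : Type*} {G : SimpleGraph W} (R : RibbonStructure G)

theorem tourStep_of_adj {T : SimpleGraph W} {d : G.Dart} (h : T.Adj d.fst d.snd) :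
    R.tourStep T d = R.next d.symm := if_pos h

theorem tourStep_of_not_adj {T : SimpleGraph W} {d : G.Dart} (h : ¬ T.Adj d.fst d.snd) :
    R.tourStep T d = R.next d := if_neg h

theorem next_injective : Function.Injective R.next := by
  rintro ⟨⟨x, y⟩, hxy⟩ ⟨⟨x', y'⟩, hxy'⟩ h
  have h1 : x = x' := congrArg (fun d : G.Dart => d.fst) h
  subst h1
  have h2 : ((R.rot x ⟨y, hxy⟩ : G.neighborSet x) : W) = R.rot x ⟨y', hxy'⟩ :=
    congrArg (fun d : G.Dart => d.snd) h
  have h3 := (R.rot x).injective (Subtype.ext h2)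
  cases h3
  rfl

theorem tourStep_injective (T : SimpleGraph W) : Function.Injective (R.tourStep T) := by
  intro d d' h
  by_cases h1 : T.Adj d.fst d.snd <;> by_cases h2 : T.Adj d'.fst d'.snd
  · rw [R.tourStep_of_adj h1, R.tourStep_of_adj h2] at h
    exact Dart.symm_involutive.injective (R.next_injective h)
  · rw [R.tourStep_of_adj h1, R.tourStep_of_not_adj h2] at h
    rw [← R.next_injective h] at h2
    exact absurd h1.symm h2
  · rw [R.tourStep_of_not_adj h1, R.tourStep_of_adj h2] at h
    rw [R.next_injective h] at h1
    exact absurd h2.symm h1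
  · rw [R.tourStep_of_not_adj h1, R.tourStep_of_not_adj h2] at h
    exact R.next_injective h

theorem tour_succ (b : G.Dart) (T : SimpleGraph W) (i : ℕ) :
    R.tour b T (i + 1) = R.tourStep T (R.tour b T i) :=
  Function.iterate_succ_apply' _ _ _

section Cut

variable {R} {T : SimpleGraph W} {S : Set W} {d : G.Dart}

theorem tourStep_fst_mem_iff (hS : T.IsCut d.fst d.snd S) {c : G.Dart} (h1 : c ≠ d)
    (h2 : c ≠ d.symm) : (R.tourStep T c).fst ∈ S ↔ c.fst ∈ S := by
  by_cases hc : T.Adj c.fst c.snd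
  · rw [R.tourStep_of_adj hc]
    change c.snd ∈ S ↔ c.fst ∈ S
    constructor
    · intro h
      by_contra h'
      obtain ⟨h3, h4⟩ := hS.eq_of_cross _ _ hc.symm h h'
      exact h1 (Dart.ext _ _ (Prod.ext h4 h3))
    · intro h
      by_contra h'
      obtain ⟨h3, h4⟩ := hS.eq_of_cross _ _ hc h h'
      exact h2 (Dart.ext _ _ (Prod.ext h3 h4))
  · rw [R.tourStep_of_not_adj hc]; rfl

end Cut

/-- The first time at which the node-edge pair `d` is current. -/
noncomputable def pairTime (b : G.Dart) (T : SimpleGraph W) (d : G.Dart) : ℕ :=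
  sInf {i | R.tour b T i = d}

/-- The first time at which the node `x` is current. -/
noncomputable def nodeTime (b : G.Dart) (T : SimpleGraph W) (x : W) : ℕ :=
  sInf {i | (R.tour b T i).fst = x}

theorem pairTime_le {R : RibbonStructure G} {b : G.Dart} {T : SimpleGraph W} {d : G.Dart} {i : ℕ} (h : R.tour b T i = d) : R.pairTime b T d ≤ i :=
  Nat.sInf_le h

theorem pairTime_tour {R : RibbonStructure G} {b : G.Dart} {T : SimpleGraph W} {i : ℕ} (hi : i < R.tourLength b T) :
    R.pairTime b T (R.tour b T i) = i := by
  have h : R.tour b T (R.pairTime b T (R.tour b T i)) = R.tour b T i :=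
    Nat.sInf_mem (s := {j | R.tour b T j = R.tour b T i}) ⟨i, rfl⟩
  exact Function.iterate_injOn_Iio_minimalPeriod
    ((pairTime_le rfl).trans_lt hi : _ < R.tourLength b T) hi h

theorem nodeTime_le {R : RibbonStructure G} {b : G.Dart} {T : SimpleGraph W} {i : ℕ} {x : W} (h : (R.tour b T i).fst = x) : R.nodeTime b T x ≤ i :=
  Nat.sInf_le h

/-- The tours of `T` and `T'` make the same moves before step `k`, but not at step `k`. -/
def FirstDiff (b : G.Dart) (T T' : SimpleGraph W) (k : ℕ) : Prop :=
  (∀ i < k, (T.Adj (R.tour b T i).fst (R.tour b T i).snd ↔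
      T'.Adj (R.tour b T i).fst (R.tour b T i).snd)) ∧
    ¬ (T.Adj (R.tour b T k).fst (R.tour b T k).snd ↔
      T'.Adj (R.tour b T k).fst (R.tour b T k).snd)

section FirstDiff

variable {R} {b : G.Dart} {T T' T'' : SimpleGraph W} {k : ℕ}

theorem tour_eq_of_agree
    (h : ∀ i < k, (T.Adj (R.tour b T i).fst (R.tour b T i).snd ↔
      T'.Adj (R.tour b T i).fst (R.tour b T i).snd)) {i : ℕ} (hi : i ≤ k) :
    R.tour b T i = R.tour b T' i := by
  induction i with
  | zero => rfl
  | succ i ih =>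
    have hih := ih (by omega)
    rw [R.tour_succ, R.tour_succ, ← hih]
    have := h i (by omega)
    by_cases hadj : T.Adj (R.tour b T i).fst (R.tour b T i).snd
    · rw [R.tourStep_of_adj hadj, R.tourStep_of_adj (this.1 hadj)]
    · rw [R.tourStep_of_not_adj hadj, R.tourStep_of_not_adj (mt this.2 hadj)]

theorem FirstDiff.tour_eq (h : R.FirstDiff b T T' k) {i : ℕ} (hi : i ≤ k) :
    R.tour b T i = R.tour b T' i := tour_eq_of_agree h.1 hi

theorem FirstDiff.symm (h : R.FirstDiff b T T' k) : R.FirstDiff b T' T k := by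
  refine ⟨fun i hi => ?_, fun h' => h.2 ?_⟩
  · rw [← h.tour_eq hi.le]; exact (h.1 i hi).symm
  · rw [h.tour_eq le_rfl]; exact h'.symm

theorem FirstDiff.ne_of_lt (h : R.FirstDiff b T T' k) {i : ℕ} (hi : i < k) :
    R.tour b T i ≠ R.tour b T k ∧ R.tour b T i ≠ (R.tour b T k).symm := by
  refine ⟨fun he => h.2 ?_, fun he => h.2 ?_⟩
  · rw [← he]; exact h.1 i hi
  · have := h.1 i hi
    rw [he] at this
    rwa [T.adj_comm, T'.adj_comm]

theorem FirstDiff.pairTime_eq (h : R.FirstDiff b T T' k) :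
    R.pairTime b T (R.tour b T k) = k := by
  refine le_antisymm (pairTime_le rfl) ?_
  by_contra! hlt
  exact (h.ne_of_lt hlt).1
    (Nat.sInf_mem (s := {j | R.tour b T j = R.tour b T k}) ⟨k, rfl⟩)

theorem FirstDiff.congr_left (h : R.FirstDiff b T T' k) {j : ℕ} (hj : R.FirstDiff b T' T'' j)
    (hjk : j < k) : R.FirstDiff b T T'' j := by
  refine ⟨fun i hi => ?_, fun h' => hj.2 ?_⟩
  · have := hj.1 i hi
    rw [← h.tour_eq (by omega)] at this
    exact (h.1 i (by omega)).trans this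
  · rw [← h.tour_eq hjk.le]
    exact (h.1 j hjk).symm.trans h'

end FirstDiff

variable [Finite W]

instance : Finite G.Dart := Finite.of_injective _ Dart.toProd_injective

theorem mem_of_next_closed {O : Set G.Dart} (hO : ∀ d ∈ O, R.next d ∈ O) {d d' : G.Dart}
    (hd : d ∈ O) (h : d'.fst = d.fst) : d' ∈ O := by
  obtain ⟨⟨x, y⟩, hxy⟩ := d
  obtain ⟨⟨x', y'⟩, hxy'⟩ := d'
  simp only at h
  subst h
  obtain ⟨n, hn⟩ := ((R.cyclic x').2 (Set.mem_univ ⟨y, hxy⟩)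
    (Set.mem_univ ⟨y', hxy'⟩)).exists_nat_pow_eq
  have key : ∀ n : ℕ, (⟨(x', (((R.rot x') ^ n) ⟨y, hxy⟩ : W)),
      (((R.rot x') ^ n) ⟨y, hxy⟩).2⟩ : G.Dart) ∈ O := by
    intro n
    induction n with
    | zero => exact hd
    | succ n ih =>
      rw [pow_succ']
      exact hO _ ih
  have := key n
  rwa [hn] at this

theorem symm_mem_of_tourStep_closed {F : SimpleGraph W} (hF : F.IsAcyclic) {O : Set G.Dart}
    (hO : ∀ d ∈ O, R.tourStep F d ∈ O) {d : G.Dart} (hd : F.Adj d.fst d.snd) (hdO : d ∈ O) :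
    d.symm ∈ O := by
  induction hn : F.edgeSet.ncard using Nat.strong_induction_on generalizing F O d with
  | _ n ih
  by_contra hsymm
  set F' := F.deleteEdges {s(d.fst, d.snd)} with hF'
  have hF'ac : F'.IsAcyclic := hF.anti (deleteEdges_le _)
  have hlt : F'.edgeSet.ncard < n := by
    rw [← hn]
    refine Set.ncard_lt_ncard ?_
    rw [hF', edgeSet_deleteEdges]
    exact Set.sdiff_singleton_ssubset.2 hd
  let O' : Set G.Dart := {c | c ∈ O ∧ F'.Reachable d.snd c.fst}
  have hadj : ∀ c ∈ O', (F'.Adj c.fst c.snd ↔ F.Adj c.fst c.snd) := by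
    intro c hc
    simp only [hF', deleteEdges_adj, Set.mem_singleton_iff, and_iff_left_iff_imp]
    rintro - he
    rcases (dart_edge_eq_iff c d).1 he with rfl | rfl
    · exact hF.not_reachable_deleteEdge hd hc.2.symm
    · exact hsymm hc.1
  have hstep : ∀ c ∈ O', R.tourStep F' c ∈ O' := by
    intro c hc
    by_cases hc' : F'.Adj c.fst c.snd
    · rw [R.tourStep_of_adj hc']
      refine ⟨?_, hc.2.trans hc'.reachable⟩
      rw [← R.tourStep_of_adj ((hadj c hc).1 hc')]
      exact hO c hc.1
    · rw [R.tourStep_of_not_adj hc']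
      refine ⟨?_, hc.2⟩
      rw [← R.tourStep_of_not_adj (mt (hadj c hc).2 hc')]
      exact hO c hc.1
  have hnext : ∀ c ∈ O', R.next c ∈ O' := by
    intro c hc
    by_cases hc' : F'.Adj c.fst c.snd
    · have := hstep _ (ih _ hlt hF'ac hstep hc' hc rfl)
      rwa [R.tourStep_of_adj hc'.symm, Dart.symm_symm] at this
    · have := hstep c hc
      rwa [R.tourStep_of_not_adj hc'] at this
  have hmem : R.next d.symm ∈ O' := by
    refine ⟨?_, Reachable.refl _⟩
    rw [← R.tourStep_of_adj hd]
    exact hO d hdO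
  exact hsymm (R.mem_of_next_closed hnext hmem rfl : d.symm ∈ O').1

theorem exists_tour_eq {T : SimpleGraph W} (hT : T.IsTree) (hTG : T ≤ G) (b d : G.Dart) :
    ∃ i, R.tour b T i = d := by
  let O : Set G.Dart := {d | ∃ i, R.tour b T i = d}
  have hO : ∀ d ∈ O, R.tourStep T d ∈ O := by
    rintro d ⟨i, rfl⟩
    exact ⟨i + 1, R.tour_succ b T i⟩
  have hnext : ∀ d ∈ O, R.next d ∈ O := by
    intro d hd
    by_cases h : T.Adj d.fst d.snd
    · have := hO _ (R.symm_mem_of_tourStep_closed hT.isAcyclic hO h hd)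
      rwa [R.tourStep_of_adj h.symm, Dart.symm_symm] at this
    · have := hO d hd
      rwa [R.tourStep_of_not_adj h] at this
  have hfull : d.fst ∈ {x | ∀ c : G.Dart, c.fst = x → c ∈ O} := by
    refine (hT.connected b.fst d.fst).mem_of_closed ?_ fun c hc =>
      R.mem_of_next_closed hnext (⟨0, rfl⟩ : b ∈ O) hc
    intro p q hpq hp c hc
    refine R.mem_of_next_closed hnext (d := ⟨(q, p), (hTG hpq).symm⟩) ?_ hc
    exact R.symm_mem_of_tourStep_closed hT.isAcyclic hO (d := ⟨(p, q), hTG hpq⟩) hpq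
      (hp _ rfl)
  exact hfull d rfl

theorem tourLength_pos (b : G.Dart) (T : SimpleGraph W) : 0 < R.tourLength b T :=
  Function.minimalPeriod_pos_of_mem_periodicPts ((R.tourStep_injective T).mem_periodicPts b)

theorem tourLength_le (b : G.Dart) (T : SimpleGraph W) :
    R.tourLength b T ≤ Nat.card G.Dart := by
  have := Fintype.ofFinite G.Dart
  rw [Nat.card_eq_fintype_card]
  exact Function.minimalPeriod_le_card

section Tree

variable {R} {b : G.Dart} {T : SimpleGraph W}

theorem tour_pairTime (hT : T.IsTree) (hTG : T ≤ G) (d : G.Dart) :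
    R.tour b T (R.pairTime b T d) = d :=
  Nat.sInf_mem (s := {i | R.tour b T i = d}) (R.exists_tour_eq hT hTG b d)

theorem pairTime_lt (hT : T.IsTree) (hTG : T ≤ G) (d : G.Dart) :
    R.pairTime b T d < R.tourLength b T := by
  refine lt_of_le_of_lt (pairTime_le (i := R.pairTime b T d % R.tourLength b T) ?_)
    (Nat.mod_lt _ (R.tourLength_pos b T))
  exact Function.iterate_mod_minimalPeriod_eq.trans (tour_pairTime hT hTG d)

theorem pairBefore_iff (hT : T.IsTree) (hTG : T ≤ G) {d d' : G.Dart} :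
    R.PairBefore b T d d' ↔ R.pairTime b T d < R.pairTime b T d' := by
  constructor
  · rintro ⟨i, j, hij, hj, rfl, rfl⟩
    rwa [pairTime_tour (hij.trans hj), pairTime_tour hj]
  · exact fun h => ⟨_, _, h, pairTime_lt hT hTG d', tour_pairTime hT hTG d,
      tour_pairTime hT hTG d'⟩

theorem exists_tour_fst_eq (hT : T.IsTree) (hTG : T ≤ G) (x : W) :
    ∃ i < R.tourLength b T, (R.tour b T i).fst = x := by
  obtain ⟨d, hd⟩ : ∃ d : G.Dart, d.fst = x := by
    by_cases h : x = b.fst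
    · exact ⟨b, h.symm⟩
    · obtain ⟨w⟩ := hT.connected x b.fst
      cases w with
      | nil => exact absurd rfl h
      | cons hadj _ => exact ⟨⟨(_, _), hTG hadj⟩, rfl⟩
  exact ⟨_, pairTime_lt hT hTG d, by rw [tour_pairTime hT hTG d, hd]⟩

theorem tour_nodeTime (hT : T.IsTree) (hTG : T ≤ G) (x : W) :
    (R.tour b T (R.nodeTime b T x)).fst = x := by
  obtain ⟨i, -, hi⟩ := exists_tour_fst_eq (R := R) (b := b) hT hTG x
  exact Nat.sInf_mem (s := {i | (R.tour b T i).fst = x}) ⟨i, hi⟩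

theorem nodeTime_lt (hT : T.IsTree) (hTG : T ≤ G) (x : W) :
    R.nodeTime b T x < R.tourLength b T := by
  obtain ⟨i, hi, hx⟩ := exists_tour_fst_eq (R := R) (b := b) hT hTG x
  exact (nodeTime_le hx).trans_lt hi

theorem firstReached_iff (hT : T.IsTree) (hTG : T ≤ G) {x : W} {i : ℕ} :
    R.FirstReached b T x i ↔ i = R.nodeTime b T x := by
  constructor
  · rintro ⟨-, hx, hmin⟩
    refine le_antisymm ?_ (nodeTime_le hx)
    by_contra! h
    exact hmin _ h (tour_nodeTime hT hTG x)
  · rintro rfl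
    exact ⟨nodeTime_lt hT hTG x, tour_nodeTime hT hTG x, fun j hj h => Nat.notMem_of_lt_sInf hj h⟩

theorem reachedBefore_iff (hT : T.IsTree) (hTG : T ≤ G) {x y : W} :
    R.ReachedBefore b T x y ↔ R.nodeTime b T x < R.nodeTime b T y := by
  simp [ReachedBefore, firstReached_iff hT hTG]

theorem nodeTime_injective (hT : T.IsTree) (hTG : T ≤ G) :
    Function.Injective (R.nodeTime b T) := fun x y h => by
  rw [← tour_nodeTime (R := R) (b := b) hT hTG x, h, tour_nodeTime hT hTG y]

/-- The tour of a tree is in the far side of an edge exactly between the two passages through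
that edge. -/
theorem tour_fst_mem_iff (hT : T.IsTree) (hTG : T ≤ G) {d : G.Dart} {S : Set W}
    (hS : T.IsCut d.fst d.snd S) (hb : b.fst ∉ S) {i : ℕ} (hi : i < R.tourLength b T) :
    (R.tour b T i).fst ∈ S ↔ R.pairTime b T d < i ∧ i ≤ R.pairTime b T d.symm := by
  induction i using Nat.strong_induction_on with | _ i ih
  rcases i with _ | i
  · exact iff_of_false hb (by omega)
  have hi' : i < R.tourLength b T := by omega
  rw [R.tour_succ]
  by_cases h1 : R.tour b T i = d
  · have hid : R.pairTime b T d = i := by rw [← h1, pairTime_tour hi']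
    rw [h1, R.tourStep_of_adj hS.adj]
    refine iff_of_true hS.mem ⟨by omega, ?_⟩
    by_contra! hlt
    have := (ih _ hlt (pairTime_lt hT hTG _)).1 (by
      rw [tour_pairTime hT hTG]; exact hS.mem)
    omega
  · by_cases h2 : R.tour b T i = d.symm
    · have hid : R.pairTime b T d.symm = i := by rw [← h2, pairTime_tour hi']
      rw [h2, R.tourStep_of_adj hS.adj.symm, Dart.symm_symm]
      exact iff_of_false hS.notMem (by omega)
    · have h3 : R.pairTime b T d ≠ i := fun h => h1 (by rw [← h, tour_pairTime hT hTG])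
      have h4 : R.pairTime b T d.symm ≠ i := fun h => h2 (by rw [← h, tour_pairTime hT hTG])
      rw [tourStep_fst_mem_iff hS h1 h2, ih i (by omega) hi']
      omega

theorem fst_mem_iff (hT : T.IsTree) (hTG : T ≤ G) {d : G.Dart} {S : Set W}
    (hS : T.IsCut d.fst d.snd S) (hb : b.fst ∉ S) (c : G.Dart) :
    c.fst ∈ S ↔ R.pairTime b T d < R.pairTime b T c ∧
      R.pairTime b T c ≤ R.pairTime b T d.symm := by
  rw [← tour_fst_mem_iff hT hTG hS hb (pairTime_lt hT hTG c), tour_pairTime hT hTG]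

end Tree

section FirstDiff

variable {R} {b : G.Dart} {T T' : SimpleGraph W}

theorem exists_firstDiff_of_not_iff (hT : T.IsTree) (hTG : T ≤ G) (d : G.Dart)
    (hd : ¬ (T.Adj d.fst d.snd ↔ T'.Adj d.fst d.snd)) :
    ∃ k, R.FirstDiff b T T' k ∧ k ≤ R.pairTime b T d := by
  classical
  have hex : ∃ k, ¬ (T.Adj (R.tour b T k).fst (R.tour b T k).snd ↔
      T'.Adj (R.tour b T k).fst (R.tour b T k).snd) :=
    ⟨R.pairTime b T d, by rwa [tour_pairTime hT hTG]⟩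
  refine ⟨Nat.find hex, ⟨fun i hi => not_not.1 (Nat.find_min hex hi), Nat.find_spec hex⟩,
    Nat.find_min' hex ?_⟩
  rwa [tour_pairTime hT hTG]

theorem exists_firstDiff (hT : T.IsTree) (hTG : T ≤ G) (hTG' : T' ≤ G) (hne : T ≠ T') :
    ∃ k, R.FirstDiff b T T' k := by
  by_contra! hcon
  apply hne
  ext x y
  by_cases hxy : G.Adj x y
  · by_contra h
    obtain ⟨k, hk, -⟩ := exists_firstDiff_of_not_iff (R := R) (b := b) hT hTG ⟨(x, y), hxy⟩ h
    exact hcon k hk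
  · exact iff_of_false (fun h => hxy (hTG h)) (fun h => hxy (hTG' h))

theorem FirstDiff.lt_tourLength (hT : T.IsTree) (hTG : T ≤ G) {k : ℕ}
    (h : R.FirstDiff b T T' k) : k < R.tourLength b T := by
  rw [← h.pairTime_eq]
  exact pairTime_lt hT hTG _

variable (R b) in
/-- In a non-empty set of trees, some tree follows the preference `P` at its first difference
with any other tree of the set. -/
theorem exists_preferred {𝒯 : Set (SimpleGraph W)} (hne : 𝒯.Nonempty)
    (htree : ∀ T ∈ 𝒯, T.IsTree ∧ T ≤ G) (P : G.Dart → Prop) :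
    ∃ T ∈ 𝒯, ∀ T' ∈ 𝒯, ∀ k, R.FirstDiff b T T' k →
      (T.Adj (R.tour b T k).fst (R.tour b T k).snd ↔ P (R.tour b T k)) := by
  have key : ∀ n : ℕ, ∃ T ∈ 𝒯, ∀ T' ∈ 𝒯, ∀ k < n, R.FirstDiff b T T' k →
      (T.Adj (R.tour b T k).fst (R.tour b T k).snd ↔ P (R.tour b T k)) := by
    intro n
    induction n with
    | zero =>
      obtain ⟨T, hT⟩ := hne
      exact ⟨T, hT, fun _ _ k hk => absurd hk (Nat.not_lt_zero k)⟩
    | succ n ih =>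
      obtain ⟨T, hT, hgood⟩ := ih
      by_cases hall : ∀ T' ∈ 𝒯, R.FirstDiff b T T' n →
          (T.Adj (R.tour b T n).fst (R.tour b T n).snd ↔ P (R.tour b T n))
      · refine ⟨T, hT, fun T' hT' k hk hd => ?_⟩
        rcases Nat.lt_succ_iff_lt_or_eq.1 hk with hk | rfl
        · exact hgood T' hT' k hk hd
        · exact hall T' hT' hd
      · push Not at hall
        obtain ⟨T₁, hT₁, hd₁, hbad⟩ := hall
        refine ⟨T₁, hT₁, fun T' hT' k hk hd => ?_⟩
        rcases Nat.lt_succ_iff_lt_or_eq.1 hk with hk | rfl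
        · have := hgood T' hT' k hk (hd₁.congr_left hd hk)
          rw [← hd₁.tour_eq hk.le, ← this]
          exact (hd₁.1 k hk).symm
        · rw [← hd₁.tour_eq le_rfl]
          have := hd₁.2
          tauto
  obtain ⟨T, hT, h⟩ := key (Nat.card G.Dart)
  obtain ⟨htr, hle⟩ := htree T hT
  exact ⟨T, hT, fun T' hT' k hd => h T' hT' k
    ((hd.lt_tourLength htr hle).trans_le (R.tourLength_le b T)) hd⟩

end FirstDiff

end RibbonStructure

namespace MultiHypergraph

open SimpleGraph RibbonStructure

variable {V E : Type*} {H : MultiHypergraph V E} {R : RibbonStructure H.bip}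
  {b : H.bip.Dart} {T T' : SimpleGraph (V ⊕ E)}

theorem violetPair_symm {e : E} {v : V} (hev : v ∈ H.edge e) :
    (H.violetPair hev).symm = H.emeraldPair hev := rfl

theorem emeraldPair_symm {e : E} {v : V} (hev : v ∈ H.edge e) :
    (H.emeraldPair hev).symm = H.violetPair hev := rfl

theorem eq_violetPair_or_eq_emeraldPair (d : H.bip.Dart) :
    (∃ (e : E) (v : V) (hev : v ∈ H.edge e), d = H.violetPair hev) ∨
      ∃ (e : E) (v : V) (hev : v ∈ H.edge e), d = H.emeraldPair hev := by
  obtain ⟨⟨x, y⟩, h⟩ := d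
  rcases x with v | e <;> rcases y with w | f
  · exact absurd h not_bip_adj_inl
  · exact Or.inl ⟨f, v, h, rfl⟩
  · exact Or.inr ⟨e, w, h, rfl⟩
  · exact absurd h not_bip_adj_inr

variable [Finite V] [Finite E]

theorem IsJaegerTree.pairTime_lt (hT : H.IsJaegerTree R b T) {e : E} {v : V}
    (hev : v ∈ H.edge e) (h : ¬ T.Adj (Sum.inr e) (Sum.inl v)) :
    R.pairTime b T (H.emeraldPair hev) < R.pairTime b T (H.violetPair hev) :=
  (pairBefore_iff hT.1.2 hT.1.1).1 (hT.2 e v hev h)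

theorem IsJaegerTree.adj_of_firstDiff (hT : H.IsJaegerTree R b T) {k : ℕ}
    (hk : R.FirstDiff b T T' k) {e : E} {v : V} (hev : v ∈ H.edge e)
    (h : R.tour b T k = H.violetPair hev) : T.Adj (Sum.inr e) (Sum.inl v) := by
  by_contra hadj
  have hlt := hT.pairTime_lt hev hadj
  rw [← h, hk.pairTime_eq] at hlt
  apply (hk.ne_of_lt hlt).2
  rw [tour_pairTime hT.1.2 hT.1.1, h, violetPair_symm]

theorem IsJaegerTree.exists_emeraldPair (hT : H.IsJaegerTree R b T)
    (hT' : H.IsJaegerTree R b T') {k : ℕ} (hk : R.FirstDiff b T T' k) :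
    ∃ (e : E) (v : V) (hev : v ∈ H.edge e), R.tour b T k = H.emeraldPair hev := by
  rcases eq_violetPair_or_eq_emeraldPair (R.tour b T k) with ⟨e, v, hev, h⟩ | h
  · exfalso
    have h1 := hT.adj_of_firstDiff hk hev h
    have h2 := hT'.adj_of_firstDiff hk.symm hev (by rw [← hk.tour_eq le_rfl, h])
    apply hk.2
    rw [h]
    exact iff_of_true h1.symm h2.symm
  · exact h

/-- What the first difference of two Jaeger trees looks like, when the edge belongs to the first
of the trees. -/
theorem IsJaegerTree.exists_isCut (hT : H.IsJaegerTree R b T)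
    (hT' : H.IsJaegerTree R b T') {k : ℕ} (hk : R.FirstDiff b T T' k) {e : E} {v : V}
    {hev : v ∈ H.edge e} (hd : R.tour b T k = H.emeraldPair hev)
    (hadj : T.Adj (Sum.inr e) (Sum.inl v)) :
    ∃ S : Set (V ⊕ E), T.IsCut (Sum.inr e) (Sum.inl v) S ∧
      (∀ g w, Sum.inr g ∉ S → Sum.inl w ∈ S → ¬ T'.Adj (Sum.inr g) (Sum.inl w)) ∧
      ∀ g, Sum.inr g ∈ S → R.nodeTime b T (Sum.inr e) < R.nodeTime b T (Sum.inr g) ∧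
        R.nodeTime b T' (Sum.inr e) < R.nodeTime b T' (Sum.inr g) := by
  obtain ⟨S, hS⟩ := hT.1.2.isAcyclic.exists_isCut hadj
  have htree := hT.1.2
  have hle := hT.1.1
  have hkd : R.pairTime b T (H.emeraldPair hev) = k := by rw [← hd, hk.pairTime_eq]
  have hkl := hk.lt_tourLength htree hle
  have hnadj : ¬ T'.Adj (Sum.inr e) (Sum.inl v) := by
    intro h
    apply hk.2
    rw [hd]
    exact iff_of_true hadj h
  have hsymm : k ≤ R.pairTime b T (H.violetPair hev) := by
    by_contra! hlt
    apply (hk.ne_of_lt hlt).2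
    rw [tour_pairTime htree hle, hd, emeraldPair_symm]
  have hS' : T.IsCut (H.emeraldPair hev).fst (H.emeraldPair hev).snd S := hS
  have hb : b.fst ∉ S := by
    intro hb
    have := (fst_mem_iff (R := R) (b := b) htree hle (d := H.violetPair hev) hS'.compl
      (not_not.2 hb) (H.emeraldPair hev)).1 hS.notMem
    omega
  refine ⟨S, hS, fun g w hg hw hgw => ?_, fun g hg => ?_⟩
  · have hgw' : w ∈ H.edge g := hT'.1.1 hgw
    have hne : ¬ T.Adj (Sum.inr g) (Sum.inl w) := by
      intro h
      obtain ⟨h1, h2⟩ := hS.eq_of_cross _ _ h.symm hw hg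
      simp only [Sum.inl.injEq, Sum.inr.injEq] at h1 h2
      subst h1 h2
      exact hnadj hgw
    have h1 := (fst_mem_iff (R := R) (b := b) htree hle hS' hb (H.violetPair hgw')).1 hw
    have h2 := mt (fst_mem_iff (R := R) (b := b) htree hle hS' hb (H.emeraldPair hgw')).2 hg
    have h3 := hT.pairTime_lt hgw' hne
    have h4 : R.pairTime b T (H.emeraldPair hgw') < k := by
      refine lt_of_le_of_ne (by omega) fun heq => hne ?_
      have h5 : H.emeraldPair hgw' = H.emeraldPair hev := by
        rw [← hd, ← heq, tour_pairTime htree hle]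
      have h6 : Sum.inr g = Sum.inr e := congrArg (fun d : H.bip.Dart => d.fst) h5
      have h7 : Sum.inl w = Sum.inl v := congrArg (fun d : H.bip.Dart => d.snd) h5
      rw [h6, h7]
      exact hadj
    have h5 := hk.1 _ h4
    rw [tour_pairTime htree hle] at h5
    exact hne (h5.2 hgw)
  · have hgt : k < R.nodeTime b T (Sum.inr g) := by
      have := (tour_fst_mem_iff (R := R) (b := b) htree hle hS' hb
        (nodeTime_lt htree hle (Sum.inr g))).1 (by rwa [tour_nodeTime htree hle])
      omega
    refine ⟨(nodeTime_le (by rw [hd]; rfl)).trans_lt hgt,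
      lt_of_le_of_lt (nodeTime_le (i := k) (by rw [← hk.tour_eq le_rfl, hd]; rfl)) ?_⟩
    by_contra! hle'
    have h1 : (R.tour b T (R.nodeTime b T' (Sum.inr g))).fst = Sum.inr g := by
      rw [hk.tour_eq hle', tour_nodeTime hT'.1.2 hT'.1.1]
    have := nodeTime_le h1
    omega

end MultiHypergraph

namespace MultiHypergraph

open SimpleGraph RibbonStructure Finset

variable {V E : Type*} {H : MultiHypergraph V E} {R : RibbonStructure H.bip}
  {b : H.bip.Dart} {T T' : SimpleGraph (V ⊕ E)}

/-- The tours of `T` and `T'` part at the edge `ev` of `T`, which separates `S` from the part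
of `T` that is toured first. -/
structure Diverge (R : RibbonStructure H.bip) (b : H.bip.Dart) (T T' : SimpleGraph (V ⊕ E))
    (e : E) (v : V) (S : Set (V ⊕ E)) : Prop where
  isCut : T.IsCut (Sum.inr e) (Sum.inl v) S
  not_adj : ∀ g w, Sum.inr g ∉ S → Sum.inl w ∈ S → ¬ T'.Adj (Sum.inr g) (Sum.inl w)
  nodeTime_lt : ∀ g, Sum.inr g ∈ S → R.nodeTime b T (Sum.inr e) < R.nodeTime b T (Sum.inr g)
  nodeTime_lt' : ∀ g, Sum.inr g ∈ S →
    R.nodeTime b T' (Sum.inr e) < R.nodeTime b T' (Sum.inr g)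

theorem IsJaegerTree.exists_diverge [Finite V] [Finite E] (hT : H.IsJaegerTree R b T)
    (hT' : H.IsJaegerTree R b T') (hne : T ≠ T') :
    ∃ k e v S, R.FirstDiff b T T' k ∧ (R.tour b T k).fst = Sum.inr e ∧
      (T.Adj (R.tour b T k).fst (R.tour b T k).snd ∧ Diverge R b T T' e v S ∨
        ¬ T.Adj (R.tour b T k).fst (R.tour b T k).snd ∧ Diverge R b T' T e v S) := by
  obtain ⟨k, hk⟩ := exists_firstDiff (R := R) (b := b) hT.1.2 hT.1.1 hT'.1.1 hne
  obtain ⟨e, v, hev, hd⟩ := hT.exists_emeraldPair hT' hk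
  have h2 := hk.2
  by_cases hadj : T.Adj (R.tour b T k).fst (R.tour b T k).snd
  · obtain ⟨S, h1, h2, h3⟩ := hT.exists_isCut hT' hk hd (by rwa [hd] at hadj)
    exact ⟨k, e, v, S, hk, by rw [hd]; rfl,
      Or.inl ⟨hadj, h1, h2, fun g hg => (h3 g hg).1, fun g hg => (h3 g hg).2⟩⟩
  · have hadj' : T'.Adj (R.tour b T k).fst (R.tour b T k).snd := by tauto
    obtain ⟨S, h1, h2, h3⟩ := hT'.exists_isCut hT hk.symm (by rw [← hk.tour_eq le_rfl, hd])
      (by rwa [hd] at hadj')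
    exact ⟨k, e, v, S, hk, by rw [hd]; rfl,
      Or.inr ⟨hadj, h1, h2, fun g hg => (h3 g hg).1, fun g hg => (h3 g hg).2⟩⟩

variable [Fintype V] [Fintype E]

open Classical in
theorem Diverge.sum_lt {e : E} {v : V} {S : Set (V ⊕ E)} (h : Diverge R b T T' e v S)
    (hT : H.IsSpanningTree T) (hT' : H.IsSpanningTree T') :
    ∑ g with Sum.inr g ∈ S, emVector T g < ∑ g with Sum.inr g ∈ S, emVector T' g :=
  sum_lt_sum_of_isCut_univ hT hT' h.isCut h.not_adj

theorem Diverge.mem_of_spans_of_eq {e : E} {v : V} {S : Set (V ⊕ E)}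
    (h : Diverge R b T T' e v S) (hT : H.IsSpanningTree T) (hT' : H.IsSpanningTree T')
    {Y : Finset E} (hY : Spans H T Y) (heq : ∀ g ∉ Y, emVector T g = emVector T' g) : e ∈ Y := by
  classical
  by_contra he
  refine (h.sum_lt hT hT').not_ge ?_
  have hle := (hY.filter_of_isCut hT.1 h.isCut he).sum_le hT hT'
  have hsub : Y.filter (fun g => (Sum.inr g : V ⊕ E) ∈ S) ⊆ univ.filter (fun g => Sum.inr g ∈ S) :=
    filter_subset_filter _ (subset_univ _)
  rw [← sum_sdiff hsub, ← sum_sdiff hsub]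
  refine add_le_add (sum_le_sum fun g hg => ?_) hle
  refine (heq g fun hgY => ?_).ge
  simp only [mem_sdiff, mem_filter, mem_univ, true_and] at hg
  exact hg.2 ⟨hgY, hg.1⟩

theorem Diverge.notMem_of_spans_of_eq {e : E} {v : V} {S : Set (V ⊕ E)}
    (h : Diverge R b T T' e v S) (hT : H.IsSpanningTree T) (hT' : H.IsSpanningTree T')
    {Z : Finset E} (hZ : Spans H T' Z) (heq : ∀ g ∈ Z, emVector T g = emVector T' g) : e ∉ Z := by
  classical
  intro he
  refine (sum_lt_sum_of_isCut hT hT' h.isCut h.not_adj he hZ fun g => mem_filter).ne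
    (sum_congr rfl fun g hg => ?_)
  exact heq g (mem_filter.1 hg).1

/-- A hypertree is represented by at most one Jaeger tree. -/
theorem IsJaegerTree.eq_of_emVector_eq (hT : H.IsJaegerTree R b T)
    (hT' : H.IsJaegerTree R b T') (h : emVector T = emVector T') : T = T' := by
  by_contra hne
  obtain ⟨-, e, v, S, -, -, ⟨-, hd⟩ | ⟨-, hd⟩⟩ := hT.exists_diverge hT' hne
  · exact (hd.sum_lt hT.1 hT'.1).ne (by rw [h])
  · exact (hd.sum_lt hT'.1 hT.1).ne (by rw [h])

theorem IsJaegerTree.orderLT_iff (hT : H.IsJaegerTree R b T) {e f : E} :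
    H.orderLT R b (emVector T) e f ↔
      R.nodeTime b T (Sum.inr e) < R.nodeTime b T (Sum.inr f) := by
  constructor
  · rintro ⟨T', hT', hrep, hlt⟩
    obtain rfl := hT.eq_of_emVector_eq hT' (represents_iff.1 hrep).2.symm
    exact (reachedBefore_iff hT.1.2 hT.1.1).1 hlt
  · exact fun h => ⟨T, hT, represents_iff.2 ⟨hT.1, rfl⟩, (reachedBefore_iff hT.1.2 hT.1.1).2 h⟩

variable (R b) in
/-- Every hypertree is represented by a Jaeger tree. -/
theorem exists_isJaegerTree {h : E → ℤ} (hh : h ∈ H.hypertrees) :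
    ∃ T, H.IsJaegerTree R b T ∧ emVector T = h := by
  classical
  obtain ⟨T, ⟨hT, hTh⟩, hbest⟩ := exists_preferred R b
    (𝒯 := {T | H.IsSpanningTree T ∧ emVector T = h}) (mem_hypertrees.1 hh)
    (fun T hT => ⟨hT.1.2, hT.1.1⟩) (fun d => d.fst.isLeft)
  refine ⟨T, ⟨hT, fun e v hev hnadj => ?_⟩, hTh⟩
  rw [pairBefore_iff hT.2 hT.1]
  by_contra! hlt
  have hlt' : R.pairTime b T (H.violetPair hev) < R.pairTime b T (H.emeraldPair hev) := by
    refine lt_of_le_of_ne hlt fun heq => ?_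
    have h1 := congrArg (R.tour b T) heq
    rw [tour_pairTime hT.2 hT.1, tour_pairTime hT.2 hT.1] at h1
    exact absurd (congrArg (fun d : H.bip.Dart => d.fst) h1) (by simp [violetPair, emeraldPair])
  obtain ⟨v', S, hS, hvS⟩ : ∃ v' S, T.IsCut (Sum.inr e) (Sum.inl v') S ∧ Sum.inl v ∈ S := by
    obtain ⟨w, hw⟩ := (hT.2.connected (Sum.inr e) (Sum.inl v)).exists_isPath
    cases w with
    | @cons _ c _ hadj w =>
      rcases c with v' | f
      · obtain ⟨x, y, S, hxy, hS, he, hv⟩ := hT.2.isAcyclic.exists_isCut_of_mem_edges hw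
          (ε := s(Sum.inr e, Sum.inl v')) (by simp)
        rw [Sym2.eq_iff] at hxy
        rcases hxy with ⟨rfl, rfl⟩ | ⟨rfl, rfl⟩
        · exact ⟨v', S, hS, hv⟩
        · exact absurd hS.mem he
      · exact absurd (hT.1 hadj) not_bip_adj_inr
  have hev' : v' ∈ H.edge e := hT.1 hS.adj
  obtain ⟨a, u, hxy, hT₁, hvec⟩ := hT.exists_swap hS hS.notMem hvS rfl hev hnadj
  have hae : a = e := by
    have := hxy
    simp only [Sym2.eq_iff, Sum.inr.injEq, Sum.inl.injEq, reduceCtorEq, and_self, or_false] at this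
    exact this.1.symm
  rw [hae, add_sub_cancel_right, hTh] at hvec
  have hadj₁ : ∀ x y, (T.swapEdge (Sum.inr e) (Sum.inl v') (Sum.inr e) (Sum.inl v)).Adj x y ↔ _ :=
    fun x y => swapEdge_adj (by simp)
  obtain ⟨k, hk, hkm⟩ := exists_firstDiff_of_not_iff (R := R) (b := b)
    (T' := T.swapEdge (Sum.inr e) (Sum.inl v') (Sum.inr e) (Sum.inl v)) hT.2 hT.1
    (H.violetPair hev) (by
      intro h
      exact hnadj (h.2 ((hadj₁ _ _).2 (Or.inr Sym2.eq_swap))).symm)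
  have hpref := hbest _ ⟨hT₁, hvec⟩ k hk
  have hkt := hk.pairTime_eq
  have hk2 := hk.2
  rw [hadj₁] at hk2
  by_cases hadj : T.Adj (R.tour b T k).fst (R.tour b T k).snd
  · have he : s((R.tour b T k).fst, (R.tour b T k).snd) = s(Sum.inr e, Sum.inl v') := by tauto
    have htk : R.tour b T k = H.violetPair hev' := by
      rcases (dart_edge_eq_iff (R.tour b T k) (H.emeraldPair hev')).1 he with h | h
      · exact absurd (hpref.1 hadj) (by simp [h, emeraldPair])
      · exact h
    rw [htk] at hkt
    have hne : k ≠ R.pairTime b T (H.violetPair hev) := by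
      rintro rfl
      rw [tour_pairTime hT.2 hT.1] at hadj
      exact hnadj hadj.symm
    have hS' : T.IsCut (H.emeraldPair hev').fst (H.emeraldPair hev').snd S := hS
    have hlast : k ≤ R.pairTime b T (H.emeraldPair hev') := by
      by_contra! h
      apply (hk.ne_of_lt h).2
      rw [tour_pairTime hT.2 hT.1, htk, violetPair_symm]
    by_cases hb : b.fst ∈ S
    · have hint := fun c => fst_mem_iff (R := R) (b := b) hT.2 hT.1
        (d := H.violetPair hev') hS'.compl (not_not.2 hb) c
      have h1 := (hint (H.emeraldPair hev)).1 hS.notMem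
      have h2 := mt (hint (H.violetPair hev)).2 (not_not.2 hvS)
      rw [violetPair_symm] at h1 h2
      omega
    · have := (fst_mem_iff (R := R) (b := b) hT.2 hT.1 hS' hb (H.violetPair hev')).1 hS.mem
      omega
  · have he : s((R.tour b T k).fst, (R.tour b T k).snd) = s(Sum.inr e, Sum.inl v) := by tauto
    rcases (dart_edge_eq_iff (R.tour b T k) (H.emeraldPair hev)).1 he with h | h
    · rw [h] at hkt
      omega
    · exact absurd (hpref.2 (by simp [h, emeraldPair])) hadj

end MultiHypergraph

namespace MultiHypergraph

open SimpleGraph RibbonStructure Finset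

variable {V E : Type*} [DecidableEq E] {H : MultiHypergraph V E}
  {R : RibbonStructure H.bip} {b : H.bip.Dart} {T T' : SimpleGraph (V ⊕ E)}

theorem self_mem_crapoEm (h : E → ℤ) : h ∈ H.crapoEm R b h :=
  fun _ => ⟨fun h => absurd h (lt_irrefl _), fun h => absurd h (lt_irrefl _)⟩

variable [Fintype V] [Fintype E]

theorem sum_add_single_sub_single {E : Type*} [DecidableEq E] (h : E → ℤ) (f a : E)
    (X : Finset E) :
    ∑ e ∈ X, (h + Pi.single f 1 - Pi.single a 1 : E → ℤ) e =
      ∑ e ∈ X, h e + (if f ∈ X then 1 else 0) - (if a ∈ X then 1 else 0) := by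
  simp [sum_add_distrib, sum_sub_distrib, sum_pi_single']

theorem sum_le_sum_of_subset {E : Type*} [DecidableEq E] {h h' : E → ℤ} {X Q : Finset E}
    (hsub : X ⊆ Q) (hX : ∑ e ∈ X, h' e ≤ ∑ e ∈ X, h e) (hle : ∀ e ∈ Q, e ∉ X → h' e ≤ h e) :
    ∑ e ∈ Q, h' e ≤ ∑ e ∈ Q, h e := by
  rw [← sum_sdiff hsub, ← sum_sdiff hsub]
  refine add_le_add (sum_le_sum fun e he => ?_) hX
  rw [mem_sdiff] at he
  exact hle e he.1 he.2

/-- The two sides of a spanned set do not exchange units. -/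
theorem Spans.mem_of_isDonor {X : Finset E} (hX : Spans H T X) (hT : H.IsSpanningTree T)
    {f a : E} (hf : f ∈ X) (h : IsDonor H (emVector T) f a) : a ∈ X := by
  by_contra ha
  obtain ⟨T', hT', hvec⟩ := mem_hypertrees.1 h
  have := hX.sum_le hT hT'
  rw [hvec, sum_add_single_sub_single, if_pos hf, if_neg ha] at this
  omega

/-- The vector `h` lies below `c` on `X` and above `c` elsewhere. -/
def Splits (X : Finset E) (h c : E → ℤ) : Prop :=
  (∀ e ∈ X, h e ≤ c e) ∧ ∀ e ∉ X, c e ≤ h e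

theorem Splits.manhattanDist_le {X : Finset E} {c : E → ℤ} (hX : Spans H T X)
    (hT : H.IsSpanningTree T) (hc : Splits X (emVector T) c) (hT' : H.IsSpanningTree T') :
    manhattanDist (emVector T) c ≤ manhattanDist (emVector T') c ∧
      (manhattanDist (emVector T') c ≤ manhattanDist (emVector T) c →
        Spans H T' X ∧ Splits X (emVector T') c) := by
  have htot : ∑ e, emVector T e = ∑ e, emVector T' e :=
    le_antisymm ((spans_univ hT').sum_le hT' hT) ((spans_univ hT).sum_le hT hT')
  have hle := hX.sum_le hT hT'
  have hdist : ∀ s : E → ℤ, ∑ e, (if e ∈ X then c e - s e else s e - c e) =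
      2 * ∑ e ∈ X, c e - ∑ e, c e - 2 * ∑ e ∈ X, s e + ∑ e, s e := by
    intro s
    have h1 : ∀ e, (if e ∈ X then c e - s e else s e - c e) =
        2 * (if e ∈ X then c e else 0) - c e - 2 * (if e ∈ X then s e else 0) + s e := by
      intro e; split_ifs <;> ring
    simp only [h1, sum_add_distrib, sum_sub_distrib, ← mul_sum, sum_ite_mem, univ_inter]
  have hterm : ∀ s : E → ℤ, ∀ e ∈ (univ : Finset E),
      (if e ∈ X then c e - s e else s e - c e) ≤ |s e - c e| := by
    intro s e _
    split_ifs
    · rw [abs_sub_comm]; exact le_abs_self _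
    · exact le_abs_self _
  have hT₀ : manhattanDist (emVector T) c =
      ∑ e, (if e ∈ X then c e - emVector T e else emVector T e - c e) := by
    refine sum_congr rfl fun e _ => ?_
    split_ifs with he
    · rw [abs_sub_comm, abs_of_nonneg (sub_nonneg.2 (hc.1 e he))]
    · exact abs_of_nonneg (sub_nonneg.2 (hc.2 e he))
  have hT₁ : ∑ e, (if e ∈ X then c e - emVector T' e else emVector T' e - c e) ≤
      manhattanDist (emVector T') c := sum_le_sum (hterm _)
  have h0 := hdist (emVector T)
  have h1 := hdist (emVector T')
  refine ⟨by linarith, fun hge => ?_⟩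
  have heq : ∑ e, (if e ∈ X then c e - emVector T' e else emVector T' e - c e) =
      ∑ e, |emVector T' e - c e| := by
    change _ = manhattanDist (emVector T') c
    linarith
  refine ⟨hX.of_sum_eq hT hT' (by linarith), fun e he => ?_, fun e he => ?_⟩
  · have := (sum_eq_sum_iff_of_le (hterm _)).1 heq e (mem_univ e)
    rw [if_pos he] at this
    have := abs_nonneg (emVector T' e - c e)
    omega
  · have := (sum_eq_sum_iff_of_le (hterm _)).1 heq e (mem_univ e)
    rw [if_neg he] at this
    have := abs_nonneg (emVector T' e - c e)
    omega

/-- If no move of one unit brings `emVector T` closer to `c`, then it is separated from `c` by a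
spanned set. -/
theorem exists_splits (hT : H.IsSpanningTree T) {c : E → ℤ}
    (hloc : ∀ f a, emVector T f < c f → IsDonor H (emVector T) f a → emVector T a ≤ c a) :
    ∃ X, Spans H T X ∧ Splits X (emVector T) c := by
  classical
  have hh : emVector T ∈ H.hypertrees := mem_hypertrees.2 ⟨T, hT, rfl⟩
  refine ⟨univ.filter fun a => ∃ f, emVector T f < c f ∧ IsDonor H (emVector T) f a,
    hT.spans_of_closed ?_, ?_, ?_⟩
  · simp only [mem_filter, mem_univ, true_and]
    rintro a ⟨f, hf, hfa⟩ a' ha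
    exact ⟨f, hf, hfa.trans hh ha⟩
  · simp only [mem_filter, mem_univ, true_and]
    rintro a ⟨f, hf, hfa⟩
    exact hloc f a hf hfa
  · simp only [mem_filter, mem_univ, true_and]
    intro a ha
    by_contra! hlt
    exact ha ⟨a, hlt, isDonor_self hh a⟩

theorem IsJaegerTree.exists_splits_of_mem_crapoEm (hT : H.IsJaegerTree R b T) {c : E → ℤ}
    (hc : c ∈ H.crapoEm R b (emVector T)) : ∃ X, Spans H T X ∧ Splits X (emVector T) c := by
  refine exists_splits hT.1 fun f a hf hfa => ?_
  by_contra! ha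
  have hext := ((hc f).1 hf) a
  have hint := ((hc a).2 ha) f
  rw [hT.orderLT_iff] at hext hint
  rcases lt_trichotomy (R.nodeTime b T (Sum.inr f)) (R.nodeTime b T (Sum.inr a)) with h | h | h
  · exact hint h (isDonor_iff.1 hfa)
  · have := Sum.inr_injective (nodeTime_injective hT.1.2 hT.1.1 h)
    subst this
    omega
  · exact hext h hfa

theorem exists_splits_of_minimal {c : E → ℤ} (hT : H.IsSpanningTree T)
    (hmin : ∀ s ∈ H.hypertrees, manhattanDist (emVector T) c ≤ manhattanDist s c) :
    ∃ X, Spans H T X ∧ Splits X (emVector T) c := by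
  refine exists_splits hT fun f a hf hfa => ?_
  by_contra! ha
  have hne : f ≠ a := by rintro rfl; omega
  refine (hmin _ hfa).not_gt (sum_lt_sum (fun e _ => ?_) ⟨f, mem_univ f, ?_⟩)
  · simp only [Pi.sub_apply, Pi.add_apply, Pi.single_apply]
    by_cases h1 : e = f
    · subst h1
      simp only [if_true, hne, if_false]
      rw [abs_of_nonpos, abs_of_nonpos] <;> omega
    · by_cases h2 : e = a
      · subst h2
        simp only [if_true, h1, if_false]
        rw [abs_of_nonneg, abs_of_nonneg] <;> omega
      · simp [h1, h2]
  · simp only [Pi.sub_apply, Pi.add_apply, Pi.single_apply, if_true, hne, if_false]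
    rw [abs_of_nonpos, abs_of_neg] <;> omega

open Classical in
/-- The part of a spanned set in one component of a larger spanned set is spanned. -/
theorem Spans.filter_reachable {Y Z : Finset E} (hY : Spans H T Y) (hZ : Spans H T' Z)
    (hT : T ≤ H.bip) (hsub : Y ⊆ Z) (e : E) :
    Spans H T (Y.filter fun g => (emRestrict T' Z).Reachable (Sum.inr e) (Sum.inr g)) := by
  refine hY.restrict hT (filter_subset _ _) fun g hg g' hg' w hgw hgw' => ?_
  rw [mem_filter] at hg ⊢
  exact ⟨hg', (hg.2.trans (hZ g (hsub hg.1) w (hT hgw))).trans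
    (hZ g' (hsub hg') w (hT hgw')).symm⟩

theorem Diverge.false_of_mem_crapoEm {e : E} {v : V} {S : Set (V ⊕ E)}
    (hd : Diverge R b T T' e v S) (hT : H.IsJaegerTree R b T) (hT' : H.IsJaegerTree R b T')
    {X : Finset E} {c : E → ℤ} (hX : Spans H T X) (hX' : Spans H T' X)
    (hs : Splits X (emVector T) c) (hs' : Splits X (emVector T') c)
    (hc : c ∈ H.crapoEm R b (emVector T)) (hc' : c ∈ H.crapoEm R b (emVector T')) : False := by
  classical
  have hh : emVector T ∈ H.hypertrees := mem_hypertrees.2 ⟨T, hT.1, rfl⟩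
  have hh' : emVector T' ∈ H.hypertrees := mem_hypertrees.2 ⟨T', hT'.1, rfl⟩
  suffices h : ∃ Z X₂ : Finset E, e ∈ Z ∧ Spans H T' Z ∧ Spans H T X₂ ∧
      (∀ g ∈ X₂, g ∈ Z ∧ (emRestrict T' Z).Reachable (Sum.inr e) (Sum.inr g) ∧ Sum.inr g ∈ S) ∧
      ∀ f ∈ Z, (emRestrict T' Z).Reachable (Sum.inr e) (Sum.inr f) → Sum.inr f ∈ S →
        f ∉ X₂ → emVector T' f ≤ emVector T f by
    obtain ⟨Z, X₂, heZ, hZ, hX₂, hsub, hle⟩ := h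
    refine (sum_lt_sum_of_isCut hT.1 hT'.1 hd.isCut hd.not_adj heZ hZ fun g => mem_filter).not_ge
      (sum_le_sum_of_subset (fun g hg => mem_filter.2 (hsub g hg)) (hX₂.sum_le hT.1 hT'.1) ?_)
    intro f hf
    rw [mem_filter] at hf
    exact hle f hf.1 hf.2.1 hf.2.2
  by_cases heX : e ∈ X
  · set Q := X.filter (fun g => (emRestrict T' X).Reachable (Sum.inr e) (Sum.inr g) ∧
        Sum.inr g ∈ S)
    set X₀ := univ.filter fun a => ∃ f ∈ Q, emVector T f < emVector T' f ∧
      IsDonor H (emVector T) f a with hX₀def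
    have hX₀ : Spans H T X₀ := by
      refine hT.1.spans_of_closed ?_
      simp only [hX₀def, mem_filter, mem_univ, true_and]
      rintro a ⟨f, hf, hlt, hfa⟩ a' ha
      exact ⟨f, hf, hlt, hfa.trans hh ha⟩
    have hX₀X : X₀ ⊆ X := by
      intro a ha
      obtain ⟨f, hf, -, hfa⟩ := (mem_filter.1 ha).2
      exact hX.mem_of_isDonor hT.1 (mem_filter.1 hf).1 hfa
    have heX₀ : e ∉ X₀ := by
      intro he
      obtain ⟨f, hf, hlt, hfe⟩ := (mem_filter.1 he).2
      have hf' := (mem_filter.1 hf)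
      refine (hc f).1 (hlt.trans_le (hs'.1 f hf'.1)) e ?_ hfe
      exact hT.orderLT_iff.2 (hd.nodeTime_lt f hf'.2.2)
    have hX₁ := (hX₀.filter_of_isCut hT.1.1 hd.isCut heX₀).filter_reachable hX' hT.1.1
      ((filter_subset _ _).trans hX₀X) e
    refine ⟨X, _, heX, hX', hX₁, ?_, ?_⟩
    · intro g hg
      rw [mem_filter, mem_filter] at hg
      exact ⟨hX₀X hg.1.1, hg.2, hg.1.2⟩
    · intro f hfX hfr hfS hf₂
      by_contra! hlt
      apply hf₂
      rw [mem_filter, mem_filter]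
      exact ⟨⟨mem_filter.2 ⟨mem_univ f, f, mem_filter.2 ⟨hfX, hfr, hfS⟩, hlt,
        isDonor_self hh f⟩, hfS⟩, hfr⟩
  · set Z := univ.filter fun g => ∀ f, Sum.inr f ∈ S → f ∉ X →
      emVector T f < emVector T' f → ¬ IsDonor H (emVector T') g f with hZdef
    have hZ : Spans H T' Z := by
      refine hT'.1.spans_of_closed ?_
      simp only [hZdef, mem_filter, mem_univ, true_and]
      exact fun g hg a ha f hfS hfX hlt hfa => hg f hfS hfX hlt (ha.trans hh' hfa)
    have heZ : e ∈ Z := by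
      refine mem_filter.2 ⟨mem_univ e, fun f hfS hfX hlt hef => ?_⟩
      refine (hc' f).2 ((hs.2 f hfX).trans_lt hlt) e ?_ (isDonor_iff.1 hef)
      exact hT'.orderLT_iff.2 (hd.nodeTime_lt' f hfS)
    have hXZ : X ⊆ Z := fun g hg => mem_filter.2 ⟨mem_univ g, fun f _ hfX _ hgf =>
      hfX (hX'.mem_of_isDonor hT'.1 hg hgf)⟩
    have hX₁ := (hX.filter_of_isCut hT.1.1 hd.isCut heX).filter_reachable hZ hT.1.1
      ((filter_subset _ _).trans hXZ) e
    refine ⟨Z, _, heZ, hZ, hX₁, ?_, ?_⟩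
    · intro g hg
      simp only [mem_filter] at hg
      exact ⟨hXZ hg.1.1, hg.2, hg.1.2⟩
    · intro f hfZ hfr hfS hf₂
      by_contra! hlt
      refine (mem_filter.1 hfZ).2 f hfS (fun hfX => hf₂ ?_) hlt (isDonor_self hh' f)
      rw [mem_filter, mem_filter]
      exact ⟨⟨hfX, hfS⟩, hfr⟩

theorem isLeast_of_mem_crapoEm {c h : E → ℤ} (hh : h ∈ H.hypertrees)
    (hc : c ∈ H.crapoEm R b h) :
    IsLeast ((fun s => manhattanDist s c) '' H.hypertrees) (manhattanDist h c) := by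
  obtain ⟨T, hT, rfl⟩ := exists_isJaegerTree R b hh
  obtain ⟨X, hX, hs⟩ := hT.exists_splits_of_mem_crapoEm hc
  refine ⟨⟨_, hh, rfl⟩, ?_⟩
  rintro _ ⟨s, hs', rfl⟩
  obtain ⟨T', hT', rfl⟩ := mem_hypertrees.1 hs'
  exact (hs.manhattanDist_le hX hT.1 hT').1

theorem pairwiseDisjoint_crapoEm : H.hypertrees.PairwiseDisjoint (H.crapoEm R b) := by
  intro h hh h' hh' hne
  refine Set.disjoint_left.2 fun c hc hc' => hne ?_
  have hdist := (isLeast_of_mem_crapoEm hh hc).unique (isLeast_of_mem_crapoEm hh' hc')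
  obtain ⟨T, hT, rfl⟩ := exists_isJaegerTree R b hh
  obtain ⟨T', hT', rfl⟩ := exists_isJaegerTree R b hh'
  obtain ⟨X, hX, hs⟩ := hT.exists_splits_of_mem_crapoEm hc
  obtain ⟨hX', hs'⟩ := (hs.manhattanDist_le hX hT.1 hT'.1).2 hdist.ge
  by_contra hne
  obtain ⟨-, e, v, S, -, -, ⟨-, hd⟩ | ⟨-, hd⟩⟩ :=
    hT.exists_diverge hT' (fun h => hne (by rw [h]))
  · exact hd.false_of_mem_crapoEm hT hT' hX hX' hs hs' hc hc'
  · exact hd.false_of_mem_crapoEm hT' hT hX' hX hs' hs hc' hc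

/-- `T` is a Jaeger tree whose hypertree is separated from `c` by the set `X` spanned by `T`. -/
structure IsSplitJaegerTree (H : MultiHypergraph V E) (R : RibbonStructure H.bip)
    (b : H.bip.Dart) (X : Finset E) (c : E → ℤ) (T : SimpleGraph (V ⊕ E)) : Prop where
  isJaegerTree : H.IsJaegerTree R b T
  spans : Spans H T X
  splits : Splits X (emVector T) c

theorem IsSplitJaegerTree.exists_transfer {X : Finset E} {c : E → ℤ}
    (hT : IsSplitJaegerTree H R b X c T) {f a : E}
    (hfa : IsDonor H (emVector T) f a) (hX : f ∈ X ↔ a ∈ X)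
    (hf : f ∈ X → emVector T f < c f) (ha : a ∉ X → c a < emVector T a) (hne : f ≠ a) :
    ∃ T', IsSplitJaegerTree H R b X c T' ∧
      emVector T' = emVector T + Pi.single f 1 - Pi.single a 1 := by
  obtain ⟨T', hT', hvec⟩ := exists_isJaegerTree R b hfa
  refine ⟨T', ⟨hT', hT.spans.of_sum_eq hT.isJaegerTree.1 hT'.1 ?_, ?_, ?_⟩, hvec⟩
  · rw [hvec, sum_add_single_sub_single]
    simp [hX]
  · intro e he
    have h1 := hT.splits.1 e he
    rw [hvec]
    simp only [Pi.sub_apply, Pi.add_apply, Pi.single_apply]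
    split_ifs with h2 h3 <;> grind
  · intro e he
    have h1 := hT.splits.2 e he
    rw [hvec]
    simp only [Pi.sub_apply, Pi.add_apply, Pi.single_apply]
    split_ifs with h2 h3 <;> grind

theorem IsSplitJaegerTree.mem_crapoEm {X : Finset E} {c : E → ℤ}
    (hT : IsSplitJaegerTree H R b X c T)
    (hbest : ∀ T', IsSplitJaegerTree H R b X c T' → ∀ k, R.FirstDiff b T T' k →
      (T.Adj (R.tour b T k).fst (R.tour b T k).snd ↔
        ∀ e, (R.tour b T k).fst = Sum.inr e → e ∉ X)) :
    c ∈ H.crapoEm R b (emVector T) := by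
  classical
  have hJ := hT.isJaegerTree
  have hh : emVector T ∈ H.hypertrees := mem_hypertrees.2 ⟨T, hJ.1, rfl⟩
  intro f
  constructor
  · intro hf f' hlt hff'
    rw [hJ.orderLT_iff] at hlt
    have hfX : f ∈ X := by
      by_contra hfX
      exact (hT.splits.2 f hfX).not_gt hf
    set D := univ.filter fun a => IsDonor H (emVector T) f a with hDdef
    obtain ⟨a, ha, hmin⟩ := D.exists_min_image (fun a => R.nodeTime b T (Sum.inr a))
      ⟨f, mem_filter.2 ⟨mem_univ f, isDonor_self hh f⟩⟩
    have hfa : IsDonor H (emVector T) f a := (mem_filter.1 ha).2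
    have hne : f ≠ a := by
      rintro rfl
      exact (hmin f' (mem_filter.2 ⟨mem_univ f', hff'⟩)).not_gt hlt
    have hDX : D ⊆ X := fun a' ha' =>
      hT.spans.mem_of_isDonor hJ.1 hfX (mem_filter.1 ha').2
    obtain ⟨T', hT', hvec⟩ := hT.exists_transfer hfa (iff_of_true hfX (hDX ha))
      (fun _ => hf) (fun h => absurd (hDX ha) h) hne
    have hJ' := hT'.isJaegerTree
    have hD : Spans H T D := hJ.1.spans_of_closed fun g hg a' ha' =>
      mem_filter.2 ⟨mem_univ a', (mem_filter.1 hg).2.trans hh ha'⟩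
    have hfD : f ∈ D := mem_filter.2 ⟨mem_univ f, isDonor_self hh f⟩
    have hD' : Spans H T' D := hD.of_sum_eq hJ.1 hJ'.1 (by
      rw [hvec, sum_add_single_sub_single]; simp [hfD, ha])
    have hoff : ∀ g ∉ D, emVector T g = emVector T' g := by
      intro g hg
      have h1 : g ≠ f := by rintro rfl; exact hg hfD
      have h2 : g ≠ a := by rintro rfl; exact hg ha
      rw [hvec]
      simp [h1, h2]
    obtain ⟨k, e, v, S, hk, hke, ⟨hadj, hd⟩ | ⟨hadj, hd⟩⟩ := hJ.exists_diverge hJ' (by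
      rintro rfl
      have := congrFun hvec f
      simp [hne] at this)
    · exact (hbest T' hT' k hk).1 hadj e hke (hDX (hd.mem_of_spans_of_eq hJ.1 hJ'.1 hD hoff))
    · have heD := hd.mem_of_spans_of_eq hJ'.1 hJ.1 hD' fun g hg => (hoff g hg).symm
      have hsum := hd.sum_lt hJ'.1 hJ.1
      rw [hvec, sum_add_single_sub_single] at hsum
      refine (hmin e heD).not_gt (hd.nodeTime_lt' a ?_)
      by_contra haS
      simp only [mem_filter, mem_univ, true_and, haS, if_false] at hsum
      split_ifs at hsum <;> omega
  · intro hf f' hlt hff'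
    rw [hJ.orderLT_iff] at hlt
    have hfX : f ∉ X := fun hfX => (hT.splits.1 f hfX).not_gt hf
    set U := univ.filter fun g => IsDonor H (emVector T) g f with hUdef
    have hfU : f ∈ U := mem_filter.2 ⟨mem_univ f, isDonor_self hh f⟩
    obtain ⟨a, ha, hmin⟩ := U.exists_min_image (fun a => R.nodeTime b T (Sum.inr a)) ⟨f, hfU⟩
    have haf : IsDonor H (emVector T) a f := (mem_filter.1 ha).2
    have hne : a ≠ f := by
      rintro rfl
      exact (hmin f' (mem_filter.2 ⟨mem_univ f', isDonor_iff.2 hff'⟩)).not_gt hlt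
    have hUX : ∀ g ∈ U, g ∉ X := fun g hg hgX =>
      hfX (hT.spans.mem_of_isDonor hJ.1 hgX (mem_filter.1 hg).2)
    obtain ⟨T', hT', hvec⟩ := hT.exists_transfer haf (iff_of_false (hUX a ha) hfX)
      (fun h => absurd h (hUX a ha)) (fun _ => hf) hne
    have hJ' := hT'.isJaegerTree
    have hZ : Spans H T Uᶜ := hJ.1.spans_of_closed fun g hg a' ha' => by
      rw [mem_compl] at hg ⊢
      intro ha''
      exact hg (mem_filter.2 ⟨mem_univ g, ha'.trans hh (mem_filter.1 ha'').2⟩)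
    have hZ' : Spans H T' Uᶜ := hZ.of_sum_eq hJ.1 hJ'.1 (by
      rw [hvec, sum_add_single_sub_single]; simp [hfU, ha])
    have hon : ∀ g ∈ Uᶜ, emVector T g = emVector T' g := by
      intro g hg
      rw [mem_compl] at hg
      have h1 : g ≠ f := by rintro rfl; exact hg hfU
      have h2 : g ≠ a := by rintro rfl; exact hg ha
      rw [hvec]
      simp [h1, h2]
    obtain ⟨k, e, v, S, hk, hke, ⟨hadj, hd⟩ | ⟨hadj, hd⟩⟩ := hJ.exists_diverge hJ' (by
      rintro rfl
      have := congrFun hvec f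
      simp [hne.symm] at this
      omega)
    · have heU := hd.notMem_of_spans_of_eq hJ.1 hJ'.1 hZ' hon
      rw [mem_compl, not_not] at heU
      have hsum := hd.sum_lt hJ.1 hJ'.1
      rw [hvec, sum_add_single_sub_single] at hsum
      refine (hmin e heU).not_gt (hd.nodeTime_lt a ?_)
      by_contra haS
      simp only [mem_filter, mem_univ, true_and, haS, if_false] at hsum
      split_ifs at hsum <;> omega
    · have heU := hd.notMem_of_spans_of_eq hJ'.1 hJ.1 hZ fun g hg => (hon g hg).symm
      rw [mem_compl, not_not] at heU
      refine hadj ((hbest T' hT' k hk).2 fun e' he' => ?_)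
      obtain rfl := Sum.inr_injective (hke.symm.trans he')
      exact hUX e heU

theorem exists_mem_crapoEm (hconn : H.bip.Connected) (R : RibbonStructure H.bip)
    (b : H.bip.Dart) (c : E → ℤ) : ∃ h ∈ H.hypertrees, c ∈ H.crapoEm R b h := by
  have hne : H.hypertrees.Nonempty := by
    obtain ⟨T, hle, hT⟩ := hconn.exists_isTree_le
    exact ⟨_, mem_hypertrees.2 ⟨T, ⟨hle, hT⟩, rfl⟩⟩
  have hmin : ∃ h ∈ H.hypertrees, ∀ s ∈ H.hypertrees, manhattanDist h c ≤ manhattanDist s c := by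
    let d : (E → ℤ) → ℕ := fun s => (manhattanDist s c).toNat
    refine ⟨Function.argminOn d H.hypertrees hne, Function.argminOn_mem _ _ _, fun s hs => ?_⟩
    have h1 : d (Function.argminOn d H.hypertrees hne) ≤ d s := Function.argminOn_le _ _ hs
    have h2 : 0 ≤ manhattanDist s c := sum_nonneg fun e _ => abs_nonneg _
    simp only [d] at h1 ⊢
    omega
  obtain ⟨h, hh, hmin⟩ := hmin
  obtain ⟨T₀, hT₀, rfl⟩ := exists_isJaegerTree R b hh
  obtain ⟨X, hX, hs⟩ := exists_splits_of_minimal hT₀.1 hmin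
  obtain ⟨T, hT, hbest⟩ := exists_preferred R b
    (𝒯 := {T | IsSplitJaegerTree H R b X c T}) ⟨T₀, hT₀, hX, hs⟩
    (fun T hT => ⟨hT.isJaegerTree.1.2, hT.isJaegerTree.1.1⟩)
    (fun d => ∀ e, d.fst = Sum.inr e → e ∉ X)
  exact ⟨emVector T, mem_hypertrees.2 ⟨T, hT.isJaegerTree.1, rfl⟩, hT.mem_crapoEm hbest⟩

end MultiHypergraph

theorem theorem3p5 {V E : Type*} [Finite V] [Fintype E] [DecidableEq E]
    (H : MultiHypergraph V E) (hconn : H.bip.Connected)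
    (R : RibbonStructure H.bip) (b : H.bip.Dart) :
    ((∀ h ∈ H.hypertrees, (H.crapoEm R b h).Nonempty) ∧
      H.hypertrees.PairwiseDisjoint (H.crapoEm R b) ∧
      (⋃ h ∈ H.hypertrees, H.crapoEm R b h) = Set.univ) ∧
    ∀ c : E → ℤ, ∀ h ∈ H.hypertrees, c ∈ H.crapoEm R b h →
      IsLeast ((fun s => manhattanDist s c) '' H.hypertrees) (manhattanDist h c) := by
  have := Fintype.ofFinite V
  refine ⟨⟨fun h _ => ⟨h, MultiHypergraph.self_mem_crapoEm h⟩,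
    MultiHypergraph.pairwiseDisjoint_crapoEm, ?_⟩,
    fun c h hh hc => MultiHypergraph.isLeast_of_mem_crapoEm hh hc⟩
  rw [Set.eq_univ_iff_forall]
  intro c
  obtain ⟨h, hh, hc⟩ := MultiHypergraph.exists_mem_crapoEm hconn R b c
  exact Set.mem_iUnion₂.2 ⟨h, hh, hc⟩
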